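/- Let $d\in\mathbb N_0$, $b:\mathbb R^d\to\mathbb R^d$, and let $x\mapsto\mu_x$ be a stochastic kernel on $\mathbb R^d$ with $\int y\,\mu_x(dy)=0$ for all $x$. Put $H_c(x,\alpha)=\log\int e^{\langle y,\alpha\rangle}\mu_x(dy)$ and assume: there are $\lambda>0$, $K_{\rm mgf}<\infty$ with $H_c(x,\alpha)\le K_{\rm mgf}$ for all $x$ and all $\|\alpha\|\le\lambda$; $x\mapsto\mu_x$ is continuous for the topology of weak convergence; $b$ is $C^1$, and $b$ and $Db$ are bounded. Let $a(n)\to0$ and $a(n)\sqrt n\to\infty$, let $x_0\in\mathbb R^d$, and let $X^0$ be the continuous solution on $[0,1]$ of $X^0(t)=x_0+\int_0^t b(X^0(s))\,ds$. Let $A(x)=\int yy^T\mu_x(dy)=Q(x)\Lambda(x)Q(x)^T$ be an orthogonal diagonalization. For a real number $K\ge0$ let $A_K^{-1}(x)=Q(x)\Lambda_K^{-1}(x)Q(x)^T$, where $\Lambda_K^{-1}(x)$ is diagonal with entries $\min(\lambda_i(x)^{-1},K^2)$, $\lambda_i(x)$ being the eigenvalues of $A(x)$ and $0^{-1}=\infty$,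 and let $A_K^{-1/2}(x)$ be its nonnegative definite square root. Write $\|\alpha\|_M^2=\langle\alpha,M\alpha\rangle$. Let $u\in C([0,1]:\mathbb R^d)$ and set $u_K(s)=u(s)$ if $\|u(s)\|\le K$, $u_K(s)=Ku(s)/\|u(s)\|$ otherwise. Let $\phi^{u,K}$ be the continuous solution on $[0,1]$ of $$\phi^{u,K}(t)=\int_0^t Db(X^0(s))\phi^{u,K}(s)\,ds+\int_0^t A(X^0(s))A_K^{-1/2}(X^0(s))u_K(s)\,ds .$$ For each sufficiently large $n$ let $\bar\upsilon_0^{n},\dots,\bar\upsilon_{n-1}^{n}$ be $\mathbb R^d$-valued random variables such that the conditional distribution of $\bar\upsilon_i^n$ given $\bar\upsilon_0^n,\dots,\bar\upsilon_{i-1}^n$ is $$\eta_i^{n,u,K}(dy)=\exp\{\langle y,\alpha_i^n\rangle-H_c(\bar X_i^{n,u,K},\alpha_i^n)\}\,\mu_{\bar X_i^{n,u,K}}(dy),\qquad \alpha_i^n=\frac{1}{a(n)\sqrt n}A_K^{-1/2}(X^0(i/n))\,u_K(i/n),$$ where $\bar X_0^{n,u,K}=x_0$, $\bar X_{i+1}^{n,u,K}=\bar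 X_i^{n,u,K}+\frac1n b(\bar X_i^{n,u,K})+\frac1n\bar\upsilon_i^n$. Let $X_0^{n,0}=x_0$, $X_{i+1}^{n,0}=X_i^{n,0}+\frac1n b(X_i^{n,0})$, and let $\bar Y^{n,u,K}(t)$, $t\in[0,1]$, be the piecewise linear interpolation, with $\bar Y^{n,u,K}(i/n)=\bar Y_i^{n,u,K}$, of $$\bar Y_{i+1}^{n,u,K}=\bar Y_i^{n,u,K}+\frac{a(n)}{\sqrt n}\bigl(b(\bar X_i^{n,u,K})-b(X_i^{n,0})\bigr)+\frac{a(n)}{\sqrt n}\bar\upsilon_i^n,\qquad \bar Y_0^{n,u,K}=0 .$$ Then $\bar Y^{n,u,K}\to\phi^{u,K}$ in $C([0,1]:\mathbb R^d)$ (uniform norm) in probability, and, with $R(\cdot\|\cdot)$ denoting relative entropy, $$\limsup_{n\to\infty}a(n)^2n\,E\Bigl[\frac1n\sum_{i=0}^{n-1}R\bigl(\eta_i^{n,u,K}\,\big\|\,\mu_{\bar X_i^{n,u,K}}\bigr)\Bigr]\le\frac12\int_0^1\bigl\|A_K^{-1/2}(X^0(s))u_K(s)\bigr\|_{A(X^0(s))}^2\,ds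 .$$ -/

import Mathlib

open MeasureTheory ProbabilityTheory Filter Topology Set
open scoped ENNReal RealInnerProductSpace

noncomputable section

namespace ModerateDeviations

/-- The state space `ℝ^d` with its Euclidean structure. -/
abbrev Vec (d : ℕ) := EuclideanSpace ℝ (Fin d)

variable {d : ℕ}

/-- The log moment generating function `H_c(x, α) = log ∫ e^{⟨y, α⟩} μ_x(dy)`, with values in
the extended reals. -/
def logMGF (μ : Kernel (Vec d) (Vec d)) (x α : Vec d) : EReal :=
  ENNReal.log (∫⁻ y, ENNReal.ofReal (Real.exp ⟪y, α⟫) ∂(μ x))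

/-- The noise distribution `μ_x` as a point of the space of probability measures, which carries
the topology of weak convergence. -/
def noiseLaw (μ : Kernel (Vec d) (Vec d)) [IsMarkovKernel μ] (x : Vec d) :
    ProbabilityMeasure (Vec d) :=
  ⟨μ x, inferInstance⟩

/-- The standing assumptions on the drift `b` and on the noise kernel `μ`. -/
structure MainCondition (b : Vec d → Vec d) (μ : Kernel (Vec d) (Vec d)) [IsMarkovKernel μ] :
    Prop where
  mean_zero : ∀ x, ∫ y, y ∂(μ x) = 0
  mgf_bound : ∃ lam : ℝ, 0 < lam ∧ ∃ Kmgf : ℝ, ∀ x α : Vec d, ‖α‖ ≤ lam → logMGF μ x α ≤ Kmgf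
  weak_continuous : Continuous (noiseLaw μ)
  drift_contDiff : ContDiff ℝ 1 b
  drift_bound : ∃ Kb : ℝ, ∀ x, ‖b x‖ ≤ Kb ∧ ‖fderiv ℝ b x‖ ≤ Kb

/-- The second moment matrix `A_{ij}(x) = ∫ y_i y_j μ_x(dy)`. -/
def covMatrix (μ : Kernel (Vec d) (Vec d)) (x : Vec d) : Matrix (Fin d) (Fin d) ℝ :=
  Matrix.of fun i j => ∫ y, y i * y j ∂(μ x)

theorem covMatrix_isHermitian (μ : Kernel (Vec d) (Vec d)) (x : Vec d) :
    (covMatrix μ x).IsHermitian := by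
  ext i j
  simp [covMatrix, mul_comm]

/-- The truncated inverse `min (r⁻¹) K²` of an eigenvalue `r ≥ 0`, where the inverse of `0`
is `∞`. -/
def truncInvEigenvalue (K r : ℝ) : ℝ :=
  if r ≤ 0 then K ^ 2 else min r⁻¹ (K ^ 2)

theorem truncInvEigenvalue_nonneg (K r : ℝ) : 0 ≤ truncInvEigenvalue K r := by
  unfold truncInvEigenvalue
  split_ifs with h
  · positivity
  · exact le_min (inv_nonneg.2 (not_le.1 h).le) (by positivity)

/-- The matrix `Q(x) diag(f(λ₁), …, f(λ_d)) Q(x)ᵀ`, where `A(x) = Q(x) diag(λ₁, …, λ_d) Q(x)ᵀ`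
is an orthogonal diagonalization of `A(x)`. -/
def spectralApply (μ : Kernel (Vec d) (Vec d)) (x : Vec d) (f : ℝ → ℝ) :
    Matrix (Fin d) (Fin d) ℝ :=
  ((covMatrix_isHermitian μ x).eigenvectorUnitary : Matrix (Fin d) (Fin d) ℝ) *
    Matrix.diagonal (fun i => f ((covMatrix_isHermitian μ x).eigenvalues i)) *
    star ((covMatrix_isHermitian μ x).eigenvectorUnitary : Matrix (Fin d) (Fin d) ℝ)

/-- The truncated inverse `A_K⁻¹(x)`. -/
def truncInv (μ : Kernel (Vec d) (Vec d)) (K : ℝ) (x : Vec d) : Matrix (Fin d) (Fin d) ℝ :=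
  spectralApply μ x (truncInvEigenvalue K)

/-- `A_K^{-1/2}(x)`, the nonnegative definite square root of `A_K⁻¹(x)`
(see `truncInvSqrt_mul_self` and `truncInvSqrt_posSemidef`). -/
def truncInvSqrt (μ : Kernel (Vec d) (Vec d)) (K : ℝ) (x : Vec d) : Matrix (Fin d) (Fin d) ℝ :=
  spectralApply μ x fun r => √(truncInvEigenvalue K r)

theorem truncInvSqrt_mul_self (μ : Kernel (Vec d) (Vec d)) (K : ℝ) (x : Vec d) :
    truncInvSqrt μ K x * truncInvSqrt μ K x = truncInv μ K x := by
  unfold truncInvSqrt truncInv spectralApply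
  set U := (covMatrix_isHermitian μ x).eigenvectorUnitary
  have hU : star (U : Matrix (Fin d) (Fin d) ℝ) * (U : Matrix (Fin d) (Fin d) ℝ) = 1 :=
    Unitary.coe_star_mul_self U
  set D := Matrix.diagonal fun i =>
    √(truncInvEigenvalue K ((covMatrix_isHermitian μ x).eigenvalues i)) with hD
  have hDD : D * D = Matrix.diagonal fun i =>
      truncInvEigenvalue K ((covMatrix_isHermitian μ x).eigenvalues i) := by
    rw [hD, Matrix.diagonal_mul_diagonal]
    congr 1
    funext i
    exact Real.mul_self_sqrt (truncInvEigenvalue_nonneg _ _)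
  rw [← hDD]
  calc (U : Matrix (Fin d) (Fin d) ℝ) * D * star (U : Matrix (Fin d) (Fin d) ℝ) *
        ((U : Matrix (Fin d) (Fin d) ℝ) * D * star (U : Matrix (Fin d) (Fin d) ℝ))
      = (U : Matrix (Fin d) (Fin d) ℝ) * D *
        (star (U : Matrix (Fin d) (Fin d) ℝ) * (U : Matrix (Fin d) (Fin d) ℝ)) * D *
        star (U : Matrix (Fin d) (Fin d) ℝ) := by simp only [Matrix.mul_assoc]
    _ = _ := by rw [hU]; simp only [Matrix.mul_assoc, Matrix.one_mul]

theorem truncInvSqrt_posSemidef (μ : Kernel (Vec d) (Vec d)) (K : ℝ) (x : Vec d) :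
    (truncInvSqrt μ K x).PosSemidef := by
  unfold truncInvSqrt spectralApply
  rw [Matrix.star_eq_conjTranspose]
  exact (Matrix.PosSemidef.diagonal fun i => Real.sqrt_nonneg _).mul_mul_conjTranspose_same _

/-- The weighted square norm `‖α‖²_M = ⟨α, M α⟩`. -/
def weightedSqNorm (M : Matrix (Fin d) (Fin d) ℝ) (α : Vec d) : ℝ :=
  ⟪α, Matrix.toEuclideanLin M α⟫

/-- The truncation `u_K(s)` of `u(s)` to norm at most `K`. -/
def truncControl (u : ℝ → Vec d) (K : ℝ) (s : ℝ) : Vec d :=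
  if ‖u s‖ ≤ K then u s else (K / ‖u s‖) • u s

/-- `A_K^{-1/2}(X⁰(s)) u_K(s)`. -/
def tiltDirection (μ : Kernel (Vec d) (Vec d)) (X0 u : ℝ → Vec d) (K s : ℝ) : Vec d :=
  Matrix.toEuclideanLin (truncInvSqrt μ K (X0 s)) (truncControl u K s)

/-- `X0` is the law of large numbers limit on `[0, 1]`:
`X⁰(t) = ∫₀ᵗ b(X⁰(s)) ds + x₀`. -/
def IsLLNLimit (b : Vec d → Vec d) (x₀ : Vec d) (X0 : ℝ → Vec d) : Prop :=
  ContinuousOn X0 (Icc 0 1) ∧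
    ∀ t ∈ Icc (0 : ℝ) 1, X0 t = (∫ s in (0 : ℝ)..t, b (X0 s)) + x₀

/-- `φ` is the path `φ^{u,K}` on `[0, 1]`, that is,
`φ(t) = ∫₀ᵗ Db(X⁰(s)) φ(s) ds + ∫₀ᵗ A(X⁰(s)) A_K^{-1/2}(X⁰(s)) u_K(s) ds`. -/
def IsControlledLimit (b : Vec d → Vec d) (μ : Kernel (Vec d) (Vec d)) (X0 u : ℝ → Vec d)
    (K : ℝ) (φ : ℝ → Vec d) : Prop :=
  ContinuousOn φ (Icc 0 1) ∧
    ∀ t ∈ Icc (0 : ℝ) 1, φ t = (∫ s in (0 : ℝ)..t, fderiv ℝ b (X0 s) (φ s)) +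
      ∫ s in (0 : ℝ)..t,
        Matrix.toEuclideanLin (covMatrix μ (X0 s)) (tiltDirection μ X0 u K s)

/-- The noiseless recursion
`X^{n,0}_{i+1} = X^{n,0}_i + (1/n) b(X^{n,0}_i)`, `X^{n,0}_0 = x₀`. -/
def noiselessX (b : Vec d → Vec d) (x₀ : Vec d) (n : ℕ) : ℕ → Vec d
  | 0 => x₀
  | i + 1 => noiselessX b x₀ n i + (1 / (n : ℝ)) • b (noiselessX b x₀ n i)

/-- The `i`-th term of a finite list of noises (and `0` beyond the end of the list). -/
def noiseAt {m : ℕ} (v : Fin m → Vec d) (i : ℕ) : Vec d :=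
  if h : i < m then v ⟨i, h⟩ else 0

/-- The recursion
`X̄_{i+1} = X̄_i + (1/n) b(X̄_i) + (1/n) v_i`, `X̄_0 = x₀`, driven by the noises `v`. -/
def controlledX (b : Vec d → Vec d) (x₀ : Vec d) (n : ℕ) {m : ℕ} (v : Fin m → Vec d) :
    ℕ → Vec d
  | 0 => x₀
  | i + 1 => controlledX b x₀ n v i + (1 / (n : ℝ)) • b (controlledX b x₀ n v i) +
      (1 / (n : ℝ)) • noiseAt v i

/-- The recursion
`Ȳ_{i+1} = Ȳ_i + (a(n)/√n) (b(X̄_i) - b(X^{n,0}_i)) + (a(n)/√n) v_i`, `Ȳ_0 = 0`. -/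
def controlledY (b : Vec d → Vec d) (x₀ : Vec d) (a : ℕ → ℝ) (n : ℕ) {m : ℕ}
    (v : Fin m → Vec d) : ℕ → Vec d
  | 0 => 0
  | i + 1 => controlledY b x₀ a n v i +
      (a n / √(n : ℝ)) • (b (controlledX b x₀ n v i) - b (noiselessX b x₀ n i)) +
      (a n / √(n : ℝ)) • noiseAt v i

/-- Piecewise linear interpolation with mesh `1/n`: the value at `t ∈ [i/n, (i+1)/n]` is
`(i + 1 - n t) y_i + (n t - i) y_{i+1}`. -/
def interpolate (n : ℕ) (y : ℕ → Vec d) (t : ℝ) : Vec d :=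
  ((⌊n * t⌋₊ : ℝ) + 1 - n * t) • y ⌊n * t⌋₊ + (n * t - (⌊n * t⌋₊ : ℝ)) • y (⌊n * t⌋₊ + 1)

/-- The exponentially tilted distribution `exp{⟨y, α⟩ - H_c(x, α)} μ_x(dy)`. -/
def tiltedNoise (μ : Kernel (Vec d) (Vec d)) (x α : Vec d) : Measure (Vec d) :=
  (μ x).withDensity fun y => EReal.exp ((⟪y, α⟫ : ℝ) - logMGF μ x α)

/-- The conditional distribution `η_i^{n,u,K}` of the `i`-th noise given a list `v` of noises
that contains (at least) those with index less than `i`: the noise distribution at `X̄_i`, tilted by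
`(1/(a(n)√n)) A_K^{-1/2}(X⁰(i/n)) u_K(i/n)`. -/
def tiltedControl (b : Vec d → Vec d) (μ : Kernel (Vec d) (Vec d)) (x₀ : Vec d) (a : ℕ → ℝ)
    (X0 u : ℝ → Vec d) (K : ℝ) (n i : ℕ) {m : ℕ} (v : Fin m → Vec d) : Measure (Vec d) :=
  tiltedNoise μ (controlledX b x₀ n v i)
    ((1 / (a n * √(n : ℝ))) • tiltDirection μ X0 u K ((i : ℝ) / n))

/-- The joint distribution of `m` noises such that the conditional distribution of the `i`-th one,
given the values `v` of the earlier ones, is `κ i v`. -/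
def jointLaw (κ : (i : ℕ) → (Fin i → Vec d) → Measure (Vec d)) :
    (m : ℕ) → Measure (Fin m → Vec d)
  | 0 => Measure.dirac Fin.elim0
  | m + 1 => (jointLaw κ m).bind fun v =>
      (κ m v).map fun y => (Fin.snoc v y : Fin (m + 1) → Vec d)

/-- The joint distribution `η^{n,u,K}` of the `n` controlled noises. -/
def controlLaw (b : Vec d → Vec d) (μ : Kernel (Vec d) (Vec d)) (x₀ : Vec d) (a : ℕ → ℝ)
    (X0 u : ℝ → Vec d) (K : ℝ) (n : ℕ) : Measure (Fin n → Vec d) :=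
  jointLaw (fun i v => tiltedControl b μ x₀ a X0 u K n i v) n

/-- The uniform distance of two paths on `[0, 1]`. -/
def uniformDist (f g : ℝ → Vec d) : ℝ≥0∞ :=
  ⨆ t ∈ Icc (0 : ℝ) 1, edist (f t) (g t)

end ModerateDeviations

end

open ModerateDeviations

/-!
Write `s = a(n)√n`. The rescaled difference `s (X̄ - X^{n,0})` of the controlled and the noiseless
recursion is exactly `Ȳ` (`controlledX_eq`), so that `X̄` follows the law of large numbers limit as
long as `Ȳ` stays bounded, and the drift term of `Ȳ` is a first order difference quotient of `b`.

*The tilted noise.* The bound on the moment generating functions gives exponential moments of the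
norm, uniformly in the state (`MainCondition.exists_hasExpMoment`). Hence all Taylor expansions in
the tilt `α` are uniform: the tilted mean is `A(x) α + O(‖α‖²)`, the tilted second moment is
bounded, and the relative entropy is at most `⟨α, A(x) α⟩ / 2 + O(‖α‖³)` (`TiltExpansion`). As `α`
is of order `1 / s`, the rescaled tilted mean is `A(X̄) A_K^{-1/2}(X⁰) u_K` up to `O(1 / s)`, and
`s²` times the relative entropy is half the associated quadratic form up to `O(1 / s)`.

*Continuity.* Weak continuity of the noise and uniform integrability make `A` continuous
(`continuous_covMatrix`), and `A_K^{-1/2}` is a continuous function of `A` in the sense of the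
functional calculus (`continuous_truncInvSqrt`). All integrands are therefore continuous along the
limit path, and the left Riemann sums converge uniformly (`eventually_riemannSum_sub_le`).

*The fluctuations.* The centred noises form a martingale whose variance after `n` steps is at most
`C a(n)² → 0`. Stopping it when its norm reaches `ε` turns the second moment bound into a maximal
inequality (`jointLaw_stoppedSum_ge_le`), proved by induction along the construction of the joint
law.

On the event that the martingale stays small everything is deterministic: a discrete Gronwall
inequality bounds `Ȳ` and then compares it with `φ^{u,K}` at the grid points
(`norm_controlledY_sub_le`), and interpolation gives uniform convergence. On the same event the
entropy cost is close to a Riemann sum of its limit; on the complement it is bounded, and that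
event has vanishing probability.
-/

namespace ModerateDeviations

/-! ### Exponential moments -/

theorem abs_exp_sub_one_sub_self_le (t : ℝ) :
    |Real.exp t - 1 - t| ≤ |t| ^ 2 * Real.exp |t| := by
  have h := Complex.norm_exp_sub_sum_le_norm_mul_exp (t : ℂ) 2
  rw [Complex.norm_real, Real.norm_eq_abs] at h
  rw [← Real.norm_eq_abs, ← Complex.norm_real]
  convert h using 2
  simp [Finset.sum_range_succ, sub_sub]

theorem abs_exp_sub_quadratic_le (t : ℝ) :
    |Real.exp t - 1 - t - t ^ 2 / 2| ≤ |t| ^ 3 * Real.exp |t| := by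
  have h := Complex.norm_exp_sub_sum_le_norm_mul_exp (t : ℂ) 3
  rw [Complex.norm_real, Real.norm_eq_abs] at h
  rw [← Real.norm_eq_abs, ← Complex.norm_real]
  convert h using 2
  simp [Finset.sum_range_succ, sub_sub, Nat.factorial, add_assoc]

/-- The weight `(1 + ‖y‖)⁴ e^{L‖y‖}`, which dominates every integrand that occurs when a measure
is tilted by `e^{⟨y, α⟩}` with `‖α‖ ≤ L`. -/
noncomputable def expWeight {d : ℕ} (L : ℝ) (y : Vec d) : ℝ :=
  (1 + ‖y‖) ^ 4 * Real.exp (L * ‖y‖)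

/-- `ν` has mean zero, and the exponential weight `expWeight L` has integral at most `C`. -/
structure HasExpMoment {d : ℕ} (ν : Measure (Vec d)) (L C : ℝ) : Prop where
  integrable : Integrable (expWeight L) ν
  integral_le : ∫ y, expWeight L y ∂ν ≤ C
  mean_zero : ∫ y, y ∂ν = 0

/-- If `y ≠ 0`, some coordinate has size at least `‖y‖ / (d + 1)`, so exponential moments of the
coordinates control one of the norm. -/
theorem exp_mul_norm_le_sum {d : ℕ} (lam : ℝ) (hlam : 0 < lam) (y : Vec d) :
    Real.exp (lam / (d + 1) * ‖y‖) ≤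
      1 + ∑ i, (Real.exp (lam * y i) + Real.exp (-lam * y i)) := by
  have hsum : ∀ i : Fin d, Real.exp (lam * |y i|) ≤
      ∑ i, (Real.exp (lam * y i) + Real.exp (-lam * y i)) := by
    intro i
    refine le_trans ?_ (Finset.single_le_sum (f := fun i =>
      Real.exp (lam * y i) + Real.exp (-lam * y i)) (fun j _ => by positivity) (Finset.mem_univ i))
    rcases abs_cases (y i) with ⟨h, _⟩ | ⟨h, _⟩ <;> rw [h]
    · have := Real.exp_pos (-lam * y i); linarith
    · have := Real.exp_pos (lam * y i)
      rw [mul_neg, ← neg_mul]; linarith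
  have hd : (0 : ℝ) < d + 1 := by positivity
  by_cases hy : ∃ i, ‖y‖ ≤ (d + 1) * |y i|
  · obtain ⟨i, hi⟩ := hy
    have : lam / (d + 1) * ‖y‖ ≤ lam * |y i| := by
      calc lam / (d + 1) * ‖y‖ ≤ lam / (d + 1) * ((d + 1) * |y i|) := by gcongr
        _ = lam * |y i| := by field_simp
    have := (Real.exp_le_exp.2 this).trans (hsum i)
    linarith
  · push Not at hy
    have h0 : ‖y‖ ^ 2 * (d + 1) ^ 2 ≤ d * ‖y‖ ^ 2 := by
      rw [EuclideanSpace.norm_sq_eq y, Finset.sum_mul]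
      calc ∑ i, ‖y i‖ ^ 2 * ((d : ℝ) + 1) ^ 2 ≤ ∑ _i : Fin d, ‖y‖ ^ 2 := by
            refine Finset.sum_le_sum fun i _ => ?_
            rw [← mul_pow]
            refine pow_le_pow_left₀ (by positivity) ?_ 2
            rw [Real.norm_eq_abs, mul_comm]; exact (hy i).le
        _ = d * ∑ i, ‖y i‖ ^ 2 := by simp [EuclideanSpace.norm_sq_eq y]
    have h1 : ‖y‖ ^ 2 = 0 := by
      have : (0 : ℝ) ≤ d := by positivity
      nlinarith [sq_nonneg ‖y‖, mul_nonneg this (sq_nonneg ‖y‖),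
        mul_nonneg (mul_nonneg this this) (sq_nonneg ‖y‖)]
    have h2 : ‖y‖ = 0 := by simpa using h1
    rw [h2, mul_zero, Real.exp_zero]
    have : 0 ≤ ∑ i, (Real.exp (lam * y i) + Real.exp (-lam * y i)) :=
      Finset.sum_nonneg fun i _ => by positivity
    linarith

theorem expWeight_le {d : ℕ} {L : ℝ} (hL : 0 < L) (y : Vec d) :
    expWeight (L / 2) y ≤ (24 / (L / 2) ^ 4 * Real.exp (L / 2)) * Real.exp (L * ‖y‖) := by
  have h := Real.pow_div_factorial_le_exp (L / 2 * (1 + ‖y‖)) (by positivity) 4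
  have h1 : (1 + ‖y‖) ^ 4 ≤ 24 / (L / 2) ^ 4 * Real.exp (L / 2 * (1 + ‖y‖)) := by
    rw [mul_pow] at h
    simp only [Nat.factorial] at h
    norm_num at h ⊢
    rw [div_mul_eq_mul_div, le_div_iff₀ (by positivity)]
    linarith
  calc expWeight (L / 2) y
      ≤ 24 / (L / 2) ^ 4 * Real.exp (L / 2 * (1 + ‖y‖)) * Real.exp (L / 2 * ‖y‖) := by
        unfold expWeight; gcongr
    _ = _ := by
        rw [mul_assoc, mul_assoc, ← Real.exp_add, ← Real.exp_add]; ring_nf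

theorem continuous_expWeight {d : ℕ} (L : ℝ) : Continuous (expWeight (d := d) L) := by
  unfold expWeight; fun_prop

theorem lintegral_exp_inner_le {d : ℕ} {μ : Kernel (Vec d) (Vec d)} {x α : Vec d} {k : ℝ}
    (h : logMGF μ x α ≤ k) :
    ∫⁻ y, ENNReal.ofReal (Real.exp ⟪y, α⟫) ∂(μ x) ≤ ENNReal.ofReal (Real.exp k) := by
  rw [← EReal.exp_coe]
  have := EReal.expOrderIso.monotone h
  simpa [logMGF] using this

/-- A uniform bound on the logarithmic moment generating functions near the origin controls
exponential moments of the norm, uniformly in the state. -/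
theorem MainCondition.exists_hasExpMoment {d : ℕ} {b : Vec d → Vec d}
    {μ : Kernel (Vec d) (Vec d)} [IsMarkovKernel μ] (h : MainCondition b μ) :
    ∃ L C : ℝ, 0 < L ∧ ∀ x, HasExpMoment (μ x) L C := by
  obtain ⟨lam, hlam, k, hk⟩ := h.mgf_bound
  set L := lam / (d + 1) with hL
  have hLpos : 0 < L := by positivity
  set c := 24 / (L / 2) ^ 4 * Real.exp (L / 2) with hc
  have hcpos : 0 < c := by positivity
  set D : ℝ := 1 + ∑ _i : Fin d, (Real.exp k + Real.exp k) with hD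
  have hDpos : 0 ≤ D := by positivity
  have key : ∀ x, ∫⁻ y, ENNReal.ofReal (expWeight (L / 2) y) ∂(μ x) ≤ ENNReal.ofReal (c * D) := by
    intro x
    have hsm : ∀ (i : Fin d) (r : ℝ), |r| ≤ lam →
        ∫⁻ y, ENNReal.ofReal (Real.exp (r * y i)) ∂(μ x) ≤ ENNReal.ofReal (Real.exp k) := by
      intro i r hr
      have := lintegral_exp_inner_le (hk x (EuclideanSpace.single i r) (by simpa using hr))
      simpa [EuclideanSpace.inner_single_right, mul_comm] using this
    calc ∫⁻ y, ENNReal.ofReal (expWeight (L / 2) y) ∂(μ x)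
        ≤ ∫⁻ y, ENNReal.ofReal c * (1 + ∑ i, (ENNReal.ofReal (Real.exp (lam * y i)) +
            ENNReal.ofReal (Real.exp (-lam * y i)))) ∂(μ x) := by
          refine lintegral_mono fun y => ?_
          have h1 := (expWeight_le hLpos y).trans
            (mul_le_mul_of_nonneg_left (exp_mul_norm_le_sum lam hlam y) hcpos.le)
          refine (ENNReal.ofReal_le_ofReal h1).trans_eq ?_
          rw [ENNReal.ofReal_mul hcpos.le, ENNReal.ofReal_add zero_le_one
            (Finset.sum_nonneg fun i _ => by positivity), ENNReal.ofReal_one,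
            ENNReal.ofReal_sum_of_nonneg fun i _ => by positivity]
          congr 3
          funext i
          rw [ENNReal.ofReal_add (by positivity) (by positivity)]
      _ = ENNReal.ofReal c * (1 + ∑ i, (∫⁻ y, ENNReal.ofReal (Real.exp (lam * y i)) ∂(μ x) +
            ∫⁻ y, ENNReal.ofReal (Real.exp (-lam * y i)) ∂(μ x))) := by
          rw [lintegral_const_mul _ (by fun_prop), lintegral_add_left (by fun_prop),
            lintegral_finsetSum _ (by fun_prop)]
          congr 2
          · simp
          · refine Finset.sum_congr rfl fun i _ => ?_
            rw [lintegral_add_left (by fun_prop)]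
      _ ≤ ENNReal.ofReal c * (1 + ∑ _i : Fin d,
            (ENNReal.ofReal (Real.exp k) + ENNReal.ofReal (Real.exp k))) := by
          gcongr with i
          · exact hsm i lam (by rw [abs_of_pos hlam])
          · exact hsm i (-lam) (by rw [abs_neg, abs_of_pos hlam])
      _ = ENNReal.ofReal (c * D) := by
          rw [ENNReal.ofReal_mul hcpos.le, hD, ENNReal.ofReal_add zero_le_one
            (Finset.sum_nonneg fun i _ => by positivity), ENNReal.ofReal_one,
            ENNReal.ofReal_sum_of_nonneg fun i _ => by positivity]
          simp_rw [ENNReal.ofReal_add (Real.exp_pos k).le (Real.exp_pos k).le]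
  have hnn : ∀ y : Vec d, 0 ≤ expWeight (L / 2) y := fun y => by unfold expWeight; positivity
  refine ⟨L / 2, c * D, by positivity, fun x => ⟨?_, ?_, h.mean_zero x⟩⟩
  · refine ⟨(continuous_expWeight _).aestronglyMeasurable, ?_⟩
    rw [hasFiniteIntegral_iff_ofReal (ae_of_all _ hnn)]
    exact (key x).trans_lt ENNReal.ofReal_lt_top
  · rw [integral_eq_lintegral_of_nonneg_ae (ae_of_all _ hnn)
      (continuous_expWeight _).aestronglyMeasurable]
    exact ENNReal.toReal_le_of_le_ofReal (by positivity) (key x)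

/-! ### Expansion of a tilted measure -/

theorem integral_inner_const {d : ℕ} {ν : Measure (Vec d)} (h : Integrable (fun y => y) ν)
    (α : Vec d) : ∫ y, ⟪y, α⟫ ∂ν = ⟪∫ y, y ∂ν, α⟫ := by
  rw [real_inner_comm, ← integral_inner h]
  exact integral_congr_ae (ae_of_all _ fun y => real_inner_comm _ _)

namespace HasExpMoment

variable {d : ℕ} {ν : Measure (Vec d)} {L C : ℝ}

theorem integrable_of_le (h : HasExpMoment ν L C) {E : Type*} [NormedAddCommGroup E]
    [NormedSpace ℝ E] {f : Vec d → E} (hf : AEStronglyMeasurable f ν) {c : ℝ}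
    (hfc : ∀ y, ‖f y‖ ≤ c * expWeight L y) : Integrable f ν :=
  (h.integrable.const_mul c).mono' hf (ae_of_all _ hfc)

theorem norm_integral_le (h : HasExpMoment ν L C) {E : Type*} [NormedAddCommGroup E]
    [NormedSpace ℝ E] {f : Vec d → E} {c : ℝ} (hc : 0 ≤ c)
    (hfc : ∀ y, ‖f y‖ ≤ c * expWeight L y) : ‖∫ y, f y ∂ν‖ ≤ c * C := by
  refine (norm_integral_le_of_norm_le (h.integrable.const_mul c) (ae_of_all _ hfc)).trans ?_
  rw [integral_const_mul]
  exact mul_le_mul_of_nonneg_left h.integral_le hc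

end HasExpMoment

theorem pow_mul_exp_le_expWeight {d : ℕ} {L : ℝ} (y : Vec d) {k : ℕ} (hk : k ≤ 4) {r : ℝ}
    (hr : r ≤ L * ‖y‖) : ‖y‖ ^ k * Real.exp r ≤ expWeight L y := by
  unfold expWeight
  gcongr
  calc ‖y‖ ^ k ≤ (1 + ‖y‖) ^ k := by gcongr; linarith
    _ ≤ (1 + ‖y‖) ^ 4 := pow_le_pow_right₀ (by linarith [norm_nonneg y]) hk

theorem abs_inner_le_of_norm_le {d : ℕ} {L : ℝ} {α : Vec d} (hα : ‖α‖ ≤ L) (y : Vec d) :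
    |⟪y, α⟫| ≤ L * ‖y‖ := by
  refine (abs_real_inner_le_norm y α).trans ?_
  rw [mul_comm]; gcongr

/-- A power of `⟪y, α⟫` times a power of `‖y‖` times an exponential is dominated by the weight. -/
theorem pow_inner_mul_le {d : ℕ} {L : ℝ} (α y : Vec d)
    {j k : ℕ} (hjk : j + k ≤ 4) {r : ℝ} (hr : r ≤ L * ‖y‖) :
    |⟪y, α⟫| ^ j * Real.exp r * ‖y‖ ^ k ≤ ‖α‖ ^ j * expWeight L y := by
  calc |⟪y, α⟫| ^ j * Real.exp r * ‖y‖ ^ k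
      ≤ (‖y‖ * ‖α‖) ^ j * Real.exp r * ‖y‖ ^ k := by
        gcongr; exact abs_real_inner_le_norm y α
    _ = ‖α‖ ^ j * (‖y‖ ^ (j + k) * Real.exp r) := by rw [mul_pow, pow_add]; ring
    _ ≤ _ := by gcongr; exact pow_mul_exp_le_expWeight y hjk hr

namespace HasExpMoment

variable {d : ℕ} {ν : Measure (Vec d)} {L C : ℝ}

theorem integrable_exp (h : HasExpMoment ν L C) {α : Vec d} (hα : ‖α‖ ≤ L) :
    Integrable (fun y => Real.exp ⟪y, α⟫) ν := by
  refine h.integrable_of_le (c := 1) (by fun_prop) fun y => ?_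
  have := pow_inner_mul_le α y (j := 0) (k := 0) (by norm_num)
    ((le_abs_self _).trans (abs_inner_le_of_norm_le hα y))
  simpa using this

theorem integrable_exp_smul (h : HasExpMoment ν L C) {α : Vec d} (hα : ‖α‖ ≤ L) :
    Integrable (fun y => Real.exp ⟪y, α⟫ • y) ν := by
  refine h.integrable_of_le (c := 1) (by fun_prop) fun y => ?_
  have := pow_inner_mul_le α y (j := 0) (k := 1) (by norm_num)
    ((le_abs_self _).trans (abs_inner_le_of_norm_le hα y))
  simpa [norm_smul] using this

theorem integrable_exp_mul_sq (h : HasExpMoment ν L C) {α : Vec d} (hα : ‖α‖ ≤ L) :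
    Integrable (fun y => Real.exp ⟪y, α⟫ * ‖y‖ ^ 2) ν := by
  refine h.integrable_of_le (c := 1) (by fun_prop) fun y => ?_
  have := pow_inner_mul_le α y (j := 0) (k := 2) (by norm_num)
    ((le_abs_self _).trans (abs_inner_le_of_norm_le hα y))
  simpa [norm_smul] using this

theorem integrable_inner_smul (h : HasExpMoment ν L C) (hL : 0 < L) (α : Vec d) :
    Integrable (fun y => ⟪y, α⟫ • y) ν := by
  refine h.integrable_of_le (c := ‖α‖) (by fun_prop) fun y => ?_
  rw [norm_smul, Real.norm_eq_abs]
  calc |⟪y, α⟫| * ‖y‖ ≤ ‖y‖ * ‖α‖ * ‖y‖ := by gcongr; exact abs_real_inner_le_norm y α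
    _ = ‖α‖ * (‖y‖ ^ 2 * Real.exp 0) := by rw [Real.exp_zero]; ring
    _ ≤ _ := by gcongr; exact pow_mul_exp_le_expWeight y (by norm_num) (by positivity)

theorem integrable_id (h : HasExpMoment ν L C) (hL : 0 < L) : Integrable (fun y => y) ν := by
  refine h.integrable_of_le (c := 1) (by fun_prop) fun y => ?_
  have := pow_mul_exp_le_expWeight (L := L) y (k := 1) (by norm_num) (r := 0) (by positivity)
  simpa using this

theorem one_le_integral_exp [IsProbabilityMeasure ν] (h : HasExpMoment ν L C)
    (hL : 0 < L) {α : Vec d} (hα : ‖α‖ ≤ L) :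
    1 ≤ ∫ y, Real.exp ⟪y, α⟫ ∂ν := by
  have h1 : Integrable (fun y => ⟪y, α⟫) ν := (h.integrable_id hL).inner_const α
  have h0 : ∫ y, ⟪y, α⟫ ∂ν = 0 := by
    rw [integral_inner_const (h.integrable_id hL), h.mean_zero, inner_zero_left]
  calc (1 : ℝ) = ∫ y, (⟪y, α⟫ + 1) ∂ν := by
        rw [integral_add h1 (integrable_const _), h0]; simp
    _ ≤ _ := integral_mono (h1.add (integrable_const _)) (h.integrable_exp hα)
        fun y => Real.add_one_le_exp _

theorem abs_integral_exp_sub_one_le [IsProbabilityMeasure ν] (h : HasExpMoment ν L C)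
    (hL : 0 < L) {α : Vec d} (hα : ‖α‖ ≤ L) : |∫ y, Real.exp ⟪y, α⟫ ∂ν - 1| ≤ ‖α‖ ^ 2 * C := by
  have h1 : Integrable (fun y => ⟪y, α⟫) ν := (h.integrable_id hL).inner_const α
  have h0 : ∫ y, ⟪y, α⟫ ∂ν = 0 := by
    rw [integral_inner_const (h.integrable_id hL), h.mean_zero, inner_zero_left]
  have h2 : ∫ y, Real.exp ⟪y, α⟫ ∂ν - 1 = ∫ y, (Real.exp ⟪y, α⟫ - 1 - ⟪y, α⟫) ∂ν := by
    have e1 : Integrable (fun y => Real.exp ⟪y, α⟫ - 1) ν :=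
      (h.integrable_exp hα).sub (integrable_const _)
    rw [integral_sub e1 h1, integral_sub (h.integrable_exp hα) (integrable_const _), h0]
    simp
  rw [h2, ← Real.norm_eq_abs]
  refine h.norm_integral_le (by positivity) fun y => ?_
  refine (abs_exp_sub_one_sub_self_le _).trans ?_
  have := pow_inner_mul_le α y (j := 2) (k := 0) (by norm_num) (abs_inner_le_of_norm_le hα y)
  simpa using this

theorem abs_integral_exp_sub_quadratic_le [IsProbabilityMeasure ν] (h : HasExpMoment ν L C)
    (hL : 0 < L) {α : Vec d} (hα : ‖α‖ ≤ L) :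
    |∫ y, Real.exp ⟪y, α⟫ ∂ν - 1 - (1 / 2) * ⟪α, ∫ y, ⟪y, α⟫ • y ∂ν⟫| ≤ ‖α‖ ^ 3 * C := by
  have h1 : Integrable (fun y => ⟪y, α⟫) ν := (h.integrable_id hL).inner_const α
  have h0 : ∫ y, ⟪y, α⟫ ∂ν = 0 := by
    rw [integral_inner_const (h.integrable_id hL), h.mean_zero, inner_zero_left]
  have hq : Integrable (fun y => ⟪y, α⟫ ^ 2 / 2) ν := by
    have := ((h.integrable_inner_smul hL α).inner_const (𝕜 := ℝ) α).div_const 2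
    refine this.congr (ae_of_all _ fun y => ?_)
    simp only [real_inner_smul_left]; ring
  have hq' : (1 / 2) * ⟪α, ∫ y, ⟪y, α⟫ • y ∂ν⟫ = ∫ y, ⟪y, α⟫ ^ 2 / 2 ∂ν := by
    rw [← integral_inner (h.integrable_inner_smul hL α), ← integral_const_mul]
    refine integral_congr_ae (ae_of_all _ fun y => ?_)
    simp only [real_inner_smul_right, real_inner_comm]; ring
  have h2 : ∫ y, Real.exp ⟪y, α⟫ ∂ν - 1 - (1 / 2) * ⟪α, ∫ y, ⟪y, α⟫ • y ∂ν⟫ =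
      ∫ y, (Real.exp ⟪y, α⟫ - 1 - ⟪y, α⟫ - ⟪y, α⟫ ^ 2 / 2) ∂ν := by
    have e1 : Integrable (fun y => Real.exp ⟪y, α⟫ - 1) ν :=
      (h.integrable_exp hα).sub (integrable_const _)
    have e2 : Integrable (fun y => Real.exp ⟪y, α⟫ - 1 - ⟪y, α⟫) ν := e1.sub h1
    rw [integral_sub e2 hq, integral_sub e1 h1,
      integral_sub (h.integrable_exp hα) (integrable_const _), h0, hq']
    simp
  rw [h2, ← Real.norm_eq_abs]
  refine h.norm_integral_le (by positivity) fun y => ?_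
  refine (abs_exp_sub_quadratic_le _).trans ?_
  have := pow_inner_mul_le α y (j := 3) (k := 0) (by norm_num) (abs_inner_le_of_norm_le hα y)
  simpa using this

theorem norm_integral_exp_smul_sub_le (h : HasExpMoment ν L C) (hL : 0 < L) {α : Vec d}
    (hα : ‖α‖ ≤ L) :
    ‖∫ y, Real.exp ⟪y, α⟫ • y ∂ν - ∫ y, ⟪y, α⟫ • y ∂ν‖ ≤ ‖α‖ ^ 2 * C := by
  have h2 : ∫ y, Real.exp ⟪y, α⟫ • y ∂ν - ∫ y, ⟪y, α⟫ • y ∂ν =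
      ∫ y, (Real.exp ⟪y, α⟫ - 1 - ⟪y, α⟫) • y ∂ν := by
    simp_rw [sub_smul, one_smul]
    have e1 : Integrable (fun y => Real.exp ⟪y, α⟫ • y - y) ν :=
      (h.integrable_exp_smul hα).sub (h.integrable_id hL)
    rw [integral_sub e1 (h.integrable_inner_smul hL α),
      integral_sub (h.integrable_exp_smul hα) (h.integrable_id hL), h.mean_zero, sub_zero]
  rw [h2]
  refine h.norm_integral_le (by positivity) fun y => ?_
  rw [norm_smul, Real.norm_eq_abs]
  refine (mul_le_mul_of_nonneg_right (abs_exp_sub_one_sub_self_le _) (norm_nonneg _)).trans ?_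
  have := pow_inner_mul_le α y (j := 2) (k := 1) (by norm_num) (abs_inner_le_of_norm_le hα y)
  simpa using this

theorem norm_integral_exp_smul_le (h : HasExpMoment ν L C) {α : Vec d} (hα : ‖α‖ ≤ L) :
    ‖∫ y, Real.exp ⟪y, α⟫ • y ∂ν‖ ≤ C := by
  have := h.norm_integral_le (f := fun y => Real.exp ⟪y, α⟫ • y) zero_le_one fun y => ?_
  · simpa using this
  · have := pow_inner_mul_le α y (j := 0) (k := 1) (by norm_num)
      ((le_abs_self _).trans (abs_inner_le_of_norm_le hα y))
    simpa [norm_smul] using this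

theorem norm_integral_inner_smul_le (h : HasExpMoment ν L C) (hL : 0 < L) (α : Vec d) :
    ‖∫ y, ⟪y, α⟫ • y ∂ν‖ ≤ ‖α‖ * C := by
  refine h.norm_integral_le (by positivity) fun y => ?_
  rw [norm_smul, Real.norm_eq_abs]
  calc |⟪y, α⟫| * ‖y‖ ≤ ‖y‖ * ‖α‖ * ‖y‖ := by gcongr; exact abs_real_inner_le_norm y α
    _ = ‖α‖ * (‖y‖ ^ 2 * Real.exp 0) := by rw [Real.exp_zero]; ring
    _ ≤ _ := by gcongr; exact pow_mul_exp_le_expWeight y (by norm_num) (by positivity)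

theorem integral_exp_mul_sq_le (h : HasExpMoment ν L C) {α : Vec d} (hα : ‖α‖ ≤ L) :
    ∫ y, Real.exp ⟪y, α⟫ * ‖y‖ ^ 2 ∂ν ≤ C := by
  refine (integral_mono (h.integrable_exp_mul_sq hα) h.integrable fun y => ?_).trans h.integral_le
  have := pow_inner_mul_le α y (j := 0) (k := 2) (by norm_num)
    ((le_abs_self _).trans (abs_inner_le_of_norm_le hα y))
  simpa [norm_smul] using this

theorem integral_tilted_eq (α : Vec d) :
    ∫ y, y ∂(ν.tilted fun y => ⟪y, α⟫) =
      (∫ y, Real.exp ⟪y, α⟫ ∂ν)⁻¹ • ∫ y, Real.exp ⟪y, α⟫ • y ∂ν := by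
  rw [integral_tilted, ← integral_smul]
  refine integral_congr_ae (ae_of_all _ fun y => ?_)
  simp only [smul_smul, div_eq_inv_mul]

/-- The mean of the measure tilted by `α` is `∫ ⟪y, α⟫ y dν` up to second order in `α`. -/
theorem norm_integral_tilted_sub_le [IsProbabilityMeasure ν] (h : HasExpMoment ν L C)
    (hL : 0 < L) {α : Vec d} (hα : ‖α‖ ≤ L) :
    ‖∫ y, y ∂(ν.tilted fun y => ⟪y, α⟫) - ∫ y, ⟪y, α⟫ • y ∂ν‖ ≤ (C + C ^ 2) * ‖α‖ ^ 2 := by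
  rw [integral_tilted_eq]
  have hZ := h.one_le_integral_exp hL hα
  have hZ1 := h.abs_integral_exp_sub_one_le hL hα
  have hN := h.norm_integral_exp_smul_le hα
  have hNS := h.norm_integral_exp_smul_sub_le hL hα
  set Z := ∫ y, Real.exp ⟪y, α⟫ ∂ν
  set N := ∫ y, Real.exp ⟪y, α⟫ • y ∂ν
  set S := ∫ y, ⟪y, α⟫ • y ∂ν
  have hC : 0 ≤ C := (norm_nonneg _).trans hN
  have hinv : |Z⁻¹ - 1| ≤ ‖α‖ ^ 2 * C := by
    have h0 : Z⁻¹ - 1 = -((Z - 1) * Z⁻¹) := by field_simp; ring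
    rw [h0, abs_neg, abs_mul]
    have : |Z⁻¹| ≤ 1 := by
      rw [abs_of_nonneg (by positivity)]; exact inv_le_one_of_one_le₀ hZ
    calc |Z - 1| * |Z⁻¹| ≤ |Z - 1| * 1 := by gcongr
      _ ≤ _ := by linarith
  have e : Z⁻¹ • N - S = (N - S) + (Z⁻¹ - 1) • N := by rw [sub_smul, one_smul]; abel
  rw [e]
  refine (norm_add_le _ _).trans ?_
  rw [norm_smul, Real.norm_eq_abs]
  calc ‖N - S‖ + |Z⁻¹ - 1| * ‖N‖ ≤ ‖α‖ ^ 2 * C + (‖α‖ ^ 2 * C) * C := by gcongr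
    _ = _ := by ring

theorem integrable_tilted_sq (h : HasExpMoment ν L C) {α : Vec d} (hα : ‖α‖ ≤ L) :
    Integrable (fun y => ‖y‖ ^ 2) (ν.tilted fun y => ⟪y, α⟫) :=
  (integrable_tilted_iff (h.integrable_exp hα) _).2 (h.integrable_exp_mul_sq hα)

theorem integrable_tilted_id (h : HasExpMoment ν L C) {α : Vec d} (hα : ‖α‖ ≤ L) :
    Integrable (fun y => y) (ν.tilted fun y => ⟪y, α⟫) :=
  (integrable_tilted_iff (h.integrable_exp hα) _).2 (h.integrable_exp_smul hα)

theorem integral_tilted_sq_le [IsProbabilityMeasure ν] (h : HasExpMoment ν L C)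
    (hL : 0 < L) {α : Vec d} (hα : ‖α‖ ≤ L) :
    ∫ y, ‖y‖ ^ 2 ∂(ν.tilted fun y => ⟪y, α⟫) ≤ C := by
  have hZ := h.one_le_integral_exp hL hα
  rw [integral_tilted]
  have : ∀ y : Vec d, (Real.exp ⟪y, α⟫ / ∫ y, Real.exp ⟪y, α⟫ ∂ν) • ‖y‖ ^ 2 =
      (∫ y, Real.exp ⟪y, α⟫ ∂ν)⁻¹ * (Real.exp ⟪y, α⟫ * ‖y‖ ^ 2) := fun y => by
    rw [smul_eq_mul]; ring
  simp_rw [this]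
  rw [integral_const_mul]
  have h0 : 0 ≤ ∫ y, Real.exp ⟪y, α⟫ * ‖y‖ ^ 2 ∂ν := integral_nonneg fun y => by positivity
  calc _ ≤ 1 * ∫ y, Real.exp ⟪y, α⟫ * ‖y‖ ^ 2 ∂ν := by
        gcongr; exact inv_le_one_of_one_le₀ hZ
    _ ≤ C := by rw [one_mul]; exact h.integral_exp_mul_sq_le hα

/-- Orthogonality of a centred increment to a constant, in the form used for the variance of a
martingale. -/
theorem lintegral_tilted_sq_add_le [IsProbabilityMeasure ν] (h : HasExpMoment ν L C)
    (hL : 0 < L) {α : Vec d} (hα : ‖α‖ ≤ L) (z : Vec d) (c : ℝ) :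
    ∫⁻ y, ENNReal.ofReal (‖z + c • (y - ∫ y, y ∂(ν.tilted fun y => ⟪y, α⟫))‖ ^ 2)
      ∂(ν.tilted fun y => ⟪y, α⟫) ≤ ENNReal.ofReal (‖z‖ ^ 2 + c ^ 2 * C) := by
  have := isProbabilityMeasure_tilted (h.integrable_exp hα)
  have h1 := h.integrable_tilted_id hα
  have h2 := h.integrable_tilted_sq hα
  have h3 := h.integral_tilted_sq_le hL hα
  set η := ν.tilted fun y => ⟪y, α⟫
  set m := ∫ y, y ∂η with hm
  have e : ∀ y : Vec d, ‖z + c • (y - m)‖ ^ 2 =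
      (‖z - c • m‖ ^ 2 + ⟪y, (2 * c) • (z - c • m)⟫) + c ^ 2 * ‖y‖ ^ 2 := by
    intro y
    have : z + c • (y - m) = (z - c • m) + c • y := by rw [smul_sub]; abel
    rw [this, norm_add_sq_real, norm_smul, mul_pow, Real.norm_eq_abs, sq_abs,
      real_inner_smul_right, real_inner_smul_right, real_inner_comm y]
    ring
  have hi1 : Integrable (fun y : Vec d => ‖z - c • m‖ ^ 2 + ⟪y, (2 * c) • (z - c • m)⟫) η :=
    (integrable_const _).add (h1.inner_const _)
  have hin : ∫ y, ⟪y, (2 * c) • (z - c • m)⟫ ∂η = ⟪m, (2 * c) • (z - c • m)⟫ :=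
    integral_inner_const h1 _
  rw [← ofReal_integral_eq_lintegral_ofReal]
  · refine ENNReal.ofReal_le_ofReal ?_
    simp_rw [e]
    rw [integral_add hi1 (h2.const_mul _), integral_add (integrable_const _) (h1.inner_const _),
      hin, integral_const_mul]
    simp only [integral_const, probReal_univ, one_smul]
    have : ‖z - c • m‖ ^ 2 + ⟪m, (2 * c) • (z - c • m)⟫ = ‖z‖ ^ 2 - c ^ 2 * ‖m‖ ^ 2 := by
      rw [norm_sub_sq_real, norm_smul, mul_pow, Real.norm_eq_abs, sq_abs,
      real_inner_smul_right, real_inner_smul_right, inner_sub_right, real_inner_smul_right,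
      real_inner_self_eq_norm_sq, real_inner_comm z m]
      ring
    rw [this]
    have := mul_le_mul_of_nonneg_left h3 (sq_nonneg c)
    have := mul_nonneg (sq_nonneg c) (sq_nonneg ‖m‖)
    linarith
  · simp_rw [e]; exact hi1.add (h2.const_mul _)
  · exact ae_of_all _ fun y => by positivity

/-- The relative entropy of the measure tilted by `α` is at most half the variance in the
direction `α`, up to third order in `α`. -/
theorem klDiv_tilted_le [IsProbabilityMeasure ν] (h : HasExpMoment ν L C)
    (hL : 0 < L) {α : Vec d} (hα : ‖α‖ ≤ L) :
    InformationTheory.klDiv (ν.tilted fun y => ⟪y, α⟫) ν ≤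
      ENNReal.ofReal ((1 / 2) * ⟪α, ∫ y, ⟪y, α⟫ • y ∂ν⟫ +
        (2 * C + C ^ 2 + C ^ 2 * L) * ‖α‖ ^ 3) := by
  have := isProbabilityMeasure_tilted (h.integrable_exp hα)
  have h1 := h.integrable_tilted_id hα
  have hac : (ν.tilted fun y => ⟪y, α⟫) ≪ ν := tilted_absolutelyContinuous _ _
  have hllr : llr (ν.tilted fun y => ⟪y, α⟫) ν =ᵐ[ν.tilted fun y => ⟪y, α⟫]
      fun y => ⟪y, α⟫ - Real.log (∫ y, Real.exp ⟪y, α⟫ ∂ν) :=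
    hac.ae_le (log_rnDeriv_tilted_left_self (h.integrable_exp hα))
  have hint : Integrable (fun y => ⟪y, α⟫ - Real.log (∫ y, Real.exp ⟪y, α⟫ ∂ν))
      (ν.tilted fun y => ⟪y, α⟫) := (h1.inner_const α).sub (integrable_const _)
  rw [InformationTheory.klDiv_of_ac_of_integrable hac (hint.congr hllr.symm),
    integral_congr_ae hllr, integral_sub (h1.inner_const α) (integrable_const _)]
  have hin : ∫ y, ⟪y, α⟫ ∂(ν.tilted fun y => ⟪y, α⟫) =
      ⟪α, ∫ y, y ∂(ν.tilted fun y => ⟪y, α⟫)⟫ := by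
    rw [integral_inner_const h1, real_inner_comm]
  rw [hin]
  simp only [integral_const, probReal_univ, one_smul, add_sub_cancel_right]
  refine ENNReal.ofReal_le_ofReal ?_
  have hZ := h.one_le_integral_exp hL hα
  have hZ1 := h.abs_integral_exp_sub_one_le hL hα
  have hZ2 := h.abs_integral_exp_sub_quadratic_le hL hα
  have hm := h.norm_integral_tilted_sub_le hL hα
  have hC : 0 ≤ C := (norm_nonneg _).trans (h.norm_integral_exp_smul_le hα)
  set Z := ∫ y, Real.exp ⟪y, α⟫ ∂ν
  set S := ∫ y, ⟪y, α⟫ • y ∂ν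
  set m := ∫ y, y ∂(ν.tilted fun y => ⟪y, α⟫)
  have hlog : (Z - 1) - (Z - 1) ^ 2 ≤ Real.log Z := by
    have h1 := Real.one_sub_inv_le_log_of_pos (zero_lt_one.trans_le hZ)
    refine le_trans ?_ h1
    have : 1 - Z⁻¹ - ((Z - 1) - (Z - 1) ^ 2) = (Z - 1) ^ 3 * Z⁻¹ := by field_simp; ring
    have h3 : 0 ≤ (Z - 1) ^ 3 * Z⁻¹ := by
      have : 0 ≤ Z - 1 := by linarith
      positivity
    linarith
  have hsq : (Z - 1) ^ 2 ≤ C ^ 2 * L * ‖α‖ ^ 3 := by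
    calc (Z - 1) ^ 2 = |Z - 1| ^ 2 := (sq_abs _).symm
      _ ≤ (‖α‖ ^ 2 * C) ^ 2 := by gcongr
      _ = C ^ 2 * ‖α‖ * ‖α‖ ^ 3 := by ring
      _ ≤ _ := by gcongr
  have hinner : ⟪α, m⟫ ≤ ⟪α, S⟫ + (C + C ^ 2) * ‖α‖ ^ 3 := by
    have : ⟪α, m⟫ = ⟪α, S⟫ + ⟪α, m - S⟫ := by rw [inner_sub_right]; ring
    rw [this]
    have := (real_inner_le_norm α (m - S)).trans
      (mul_le_mul_of_nonneg_left hm (norm_nonneg α))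
    nlinarith
  have := (abs_le.1 hZ2).1
  nlinarith

end HasExpMoment

/-! ### The covariance matrix and the tilted noise -/

section Covariance

variable {d : ℕ} {μ : Kernel (Vec d) (Vec d)}

theorem tiltedNoise_eq_tilted {L C : ℝ} {x α : Vec d} (h : HasExpMoment (μ x) L C)
    (hL : 0 < L) [IsMarkovKernel μ] (hα : ‖α‖ ≤ L) :
    tiltedNoise μ x α = (μ x).tilted fun y => ⟪y, α⟫ := by
  have hi := h.integrable_exp hα
  have hZ := h.one_le_integral_exp hL hα
  have hlog : logMGF μ x α = (Real.log (∫ y, Real.exp ⟪y, α⟫ ∂(μ x)) : ℝ) := by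
    rw [logMGF, ← ofReal_integral_eq_lintegral_ofReal hi (ae_of_all _ fun y => (Real.exp_pos _).le),
      ENNReal.log_ofReal_of_pos (by linarith)]
  unfold tiltedNoise Measure.tilted
  congr 1
  funext y
  rw [hlog, ← EReal.coe_sub, EReal.exp_coe, Real.exp_sub, Real.exp_log (by linarith)]

theorem toEuclideanLin_covMatrix {L C : ℝ} {x : Vec d} (h : HasExpMoment (μ x) L C)
    (hL : 0 < L) (α : Vec d) :
    Matrix.toEuclideanLin (covMatrix μ x) α = ∫ y, ⟪y, α⟫ • y ∂(μ x) := by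
  have hij : ∀ i j, Integrable (fun y : Vec d => y i * y j) (μ x) := by
    intro i j
    refine h.integrable_of_le (c := 1) (by fun_prop) fun y => ?_
    rw [norm_mul, one_mul]
    calc ‖y i‖ * ‖y j‖ ≤ ‖y‖ * ‖y‖ := by gcongr <;> exact PiLp.norm_apply_le y _
      _ = ‖y‖ ^ 2 * Real.exp 0 := by rw [Real.exp_zero]; ring
      _ ≤ _ := pow_mul_exp_le_expWeight y (by norm_num) (by positivity)
  ext i
  have hp : (∫ y, ⟪y, α⟫ • y ∂(μ x)) i = ∫ y, (⟪y, α⟫ • y) i ∂(μ x) :=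
    ((EuclideanSpace.proj (𝕜 := ℝ) i).integral_comp_comm (h.integrable_inner_smul hL α)).symm
  rw [hp, Matrix.toLpLin_apply]
  simp only [Matrix.mulVec, dotProduct, covMatrix, Matrix.of_apply, PiLp.smul_apply, smul_eq_mul]
  simp_rw [← integral_mul_const]
  rw [← integral_finsetSum _ fun j _ => (hij i j).mul_const _]
  refine integral_congr_ae (ae_of_all _ fun y => ?_)
  simp only [PiLp.inner_apply, RCLike.inner_apply, conj_trivial, Finset.sum_mul]
  exact Finset.sum_congr rfl fun j _ => by ring

/-- Second moments depend continuously on the state: weak continuity of the noise is upgraded by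
truncation, the tails being controlled uniformly by the exponential moments. -/
theorem continuous_covMatrix [IsMarkovKernel μ] {L C : ℝ} (h : ∀ x, HasExpMoment (μ x) L C)
    (hL : 0 < L) (hμ : Continuous (noiseLaw μ)) : Continuous (covMatrix μ) := by
  refine continuous_pi fun i => continuous_pi fun j => ?_
  change Continuous fun x => ∫ y, y i * y j ∂(μ x)
  have hC : 0 ≤ C := by
    have := (h 0).norm_integral_exp_smul_le (α := 0) (by simpa using hL.le)
    exact (norm_nonneg _).trans this
  refine continuous_of_uniform_approx_of_continuous fun U hU => ?_
  obtain ⟨ε, hε, hεU⟩ := Metric.mem_uniformity_dist.1 hU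
  obtain ⟨R, hR⟩ := exists_gt (C / ε)
  have hR0 : 0 < R := lt_of_le_of_lt (by positivity) hR
  -- the product of two coordinates, truncated at height `R`
  let g : BoundedContinuousFunction (Vec d) ℝ :=
    BoundedContinuousFunction.ofNormedAddCommGroup (fun y : Vec d => max (-R) (min R (y i * y j)))
      (by fun_prop) R fun y => by
        rw [Real.norm_eq_abs, abs_le]
        exact ⟨le_max_left _ _, max_le (by linarith) (min_le_left _ _)⟩
  refine ⟨fun x => ∫ y, g y ∂(μ x),
    (ProbabilityMeasure.continuous_integral_boundedContinuousFunction g).comp hμ, fun x => ?_⟩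
  apply hεU
  have hprod : ∀ y : Vec d, |y i * y j| ≤ ‖y‖ ^ 2 := fun y => by
    rw [abs_mul, sq]
    exact mul_le_mul (PiLp.norm_apply_le y i) (PiLp.norm_apply_le y j) (abs_nonneg _)
      (norm_nonneg _)
  have hsq : ∀ y : Vec d, ‖y‖ ^ 2 ≤ expWeight L y := fun y => by
    simpa using pow_mul_exp_le_expWeight (L := L) y (k := 2) (by norm_num) (r := 0) (by positivity)
  have h4 : ∀ y : Vec d, ‖y‖ ^ 4 ≤ expWeight L y := fun y => by
    simpa using pow_mul_exp_le_expWeight (L := L) y (k := 4) (by norm_num) (r := 0) (by positivity)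
  have hf : Integrable (fun y : Vec d => y i * y j) (μ x) :=
    (h x).integrable_of_le (c := 1) (by fun_prop) fun y => by
      rw [one_mul]; exact (hprod y).trans (hsq y)
  rw [Real.dist_eq, ← integral_sub hf (g.integrable _), ← Real.norm_eq_abs]
  have hbd : ∀ y : Vec d, ‖y i * y j - g y‖ ≤ (1 / R) * expWeight L y := by
    intro y
    have hg : g y = max (-R) (min R (y i * y j)) := rfl
    rw [hg, Real.norm_eq_abs]
    have h1 : |y i * y j - max (-R) (min R (y i * y j))| ≤ (1 / R) * |y i * y j| ^ 2 := by
      generalize y i * y j = t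
      rw [div_mul_eq_mul_div, le_div_iff₀ hR0, one_mul]
      rcases le_total t R with h1 | h1
      · rw [min_eq_right h1]
        rcases le_total (-R) t with h2 | h2
        · rw [max_eq_right h2]; simpa using sq_nonneg t
        · rw [max_eq_left h2, abs_of_nonpos (by linarith), sq_abs]; nlinarith
      · rw [min_eq_left h1, max_eq_right (by linarith), abs_of_nonneg (by linarith), sq_abs]
        nlinarith
    refine h1.trans ?_
    gcongr
    calc |y i * y j| ^ 2 ≤ (‖y‖ ^ 2) ^ 2 := by gcongr; exact hprod y
      _ = ‖y‖ ^ 4 := by ring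
      _ ≤ _ := h4 y
  refine ((h x).norm_integral_le (by positivity) hbd).trans_lt ?_
  rw [div_mul_eq_mul_div, one_mul, div_lt_iff₀ hR0]
  rw [div_lt_iff₀ hε] at hR
  linarith

theorem continuous_sqrt_truncInvEigenvalue (K : ℝ) :
    Continuous fun r => √(truncInvEigenvalue K r) := by
  refine Real.continuous_sqrt.comp ?_
  rcases eq_or_ne K 0 with rfl | hK
  · have : truncInvEigenvalue 0 = fun _ => 0 := by
      funext r
      unfold truncInvEigenvalue
      split_ifs with h
      · simp
      · rw [zero_pow two_ne_zero, min_eq_right (inv_nonneg.2 (not_le.1 h).le)]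
    rw [this]; exact continuous_const
  · have hK2 : 0 < K ^ 2 := by positivity
    have : truncInvEigenvalue K = fun r => (max r (K ^ 2)⁻¹)⁻¹ := by
      funext r
      unfold truncInvEigenvalue
      split_ifs with h
      · rw [max_eq_right (h.trans (by positivity)), inv_inv]
      · push Not at h
        rcases le_total r (K ^ 2)⁻¹ with h1 | h1
        · rw [max_eq_right h1, inv_inv, min_eq_right ((le_inv_comm₀ h hK2).1 h1)]
        · rw [max_eq_left h1, min_eq_left ((inv_le_comm₀ hK2 h).1 h1)]
    rw [this]
    exact (continuous_id.max continuous_const).inv₀ fun r =>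
      (lt_of_lt_of_le (by positivity) (le_max_right _ _)).ne'

open scoped Matrix.Norms.L2Operator in
/-- The truncated inverse square root is a continuous function of the second moment matrix, being
given by the continuous functional calculus, although the diagonalizing matrix is not. -/
theorem continuous_truncInvSqrt (hA : Continuous (covMatrix μ)) (K : ℝ) :
    Continuous (truncInvSqrt μ K) := by
  have e : truncInvSqrt μ K = fun x => cfc (fun r => √(truncInvEigenvalue K r)) (covMatrix μ x) := by
    funext x
    rw [(covMatrix_isHermitian μ x).cfc_eq, Matrix.IsHermitian.cfc,
      Unitary.conjStarAlgAut_apply]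
    rfl
  rw [e]
  exact Continuous.cfc_of_mem_nhdsSet (s := Set.univ) _ Filter.univ_mem hA
    (fun x => covMatrix_isHermitian μ x) (continuous_sqrt_truncInvEigenvalue K).continuousOn

theorem continuous_toEuclideanLin_apply :
    Continuous fun p : Matrix (Fin d) (Fin d) ℝ × Vec d => Matrix.toEuclideanLin p.1 p.2 := by
  simp_rw [Matrix.toLpLin_apply]
  fun_prop

theorem truncControl_eq_of_nonneg {u : ℝ → Vec d} {K : ℝ} (hK : 0 ≤ K) (s : ℝ) :
    truncControl u K s = (K / max K ‖u s‖) • u s ∨ K = 0 ∧ truncControl u K s = 0 := by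
  unfold truncControl
  split_ifs with h
  · rcases hK.eq_or_lt with rfl | hK
    · exact Or.inr ⟨rfl, norm_le_zero_iff.1 h⟩
    · left; rw [max_eq_left h, div_self hK.ne', one_smul]
  · left; rw [max_eq_right (not_le.1 h).le]

theorem continuousOn_truncControl {u : ℝ → Vec d} {S : Set ℝ} (hu : ContinuousOn u S) {K : ℝ}
    (hK : 0 ≤ K) : ContinuousOn (truncControl u K) S := by
  rcases hK.eq_or_lt with rfl | hK'
  · refine continuousOn_const (c := 0) |>.congr fun s _ => ?_
    rcases truncControl_eq_of_nonneg (u := u) hK s with h | h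
    · simpa using h
    · exact h.2
  · have hpos : ∀ s, max K ‖u s‖ ≠ 0 := fun s => (lt_of_lt_of_le hK' (le_max_left _ _)).ne'
    have : ContinuousOn (fun s => (K / max K ‖u s‖) • u s) S :=
      (continuousOn_const.div (continuousOn_const.sup hu.norm) fun s _ => hpos s).smul hu
    refine this.congr fun s _ => ?_
    rcases truncControl_eq_of_nonneg (u := u) hK s with h | h
    · exact h
    · exact absurd h.1 hK'.ne'

theorem continuousOn_tiltDirection (hA : Continuous (covMatrix μ)) {X0 u : ℝ → Vec d} {S : Set ℝ}
    (hX0 : ContinuousOn X0 S) (hu : ContinuousOn u S) {K : ℝ} (hK : 0 ≤ K) :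
    ContinuousOn (tiltDirection μ X0 u K) S := by
  have h1 : ContinuousOn (fun s => truncInvSqrt μ K (X0 s)) S :=
    (continuous_truncInvSqrt hA K).comp_continuousOn hX0
  have h2 := h1.prodMk (continuousOn_truncControl hu hK)
  have h3 := (continuous_toEuclideanLin_apply (d := d)).comp_continuousOn h2
  unfold tiltDirection
  exact h3

/-- The second moment matrix as a continuous linear operator. -/
noncomputable def covOp (μ : Kernel (Vec d) (Vec d)) (x : Vec d) : Vec d →L[ℝ] Vec d :=
  (Matrix.toEuclideanLin (covMatrix μ x)).toContinuousLinearMap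

theorem covOp_apply (x α : Vec d) :
    covOp μ x α = Matrix.toEuclideanLin (covMatrix μ x) α := rfl

theorem continuous_covOp (hA : Continuous (covMatrix μ)) : Continuous (covOp μ) := by
  have : Continuous (
      (LinearMap.toContinuousLinearMap (𝕜 := ℝ) (E := Vec d) (F' := Vec d)).toLinearMap ∘ₗ
      (Matrix.toEuclideanLin (𝕜 := ℝ) (m := Fin d) (n := Fin d)).toLinearMap) :=
    LinearMap.continuous_of_finiteDimensional _
  exact this.comp hA

/-- The mean of the noise in state `x` tilted by `α`. -/
noncomputable def tiltedMean (μ : Kernel (Vec d) (Vec d)) (x α : Vec d) : Vec d :=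
  ∫ y, y ∂(tiltedNoise μ x α)

theorem measurable_tiltedMean [IsMarkovKernel μ] {L C : ℝ} (h : ∀ x, HasExpMoment (μ x) L C)
    (hL : 0 < L) {α : Vec d} (hα : ‖α‖ ≤ L) : Measurable fun x => tiltedMean μ x α := by
  simp_rw [tiltedMean, tiltedNoise_eq_tilted (h _) hL hα, HasExpMoment.integral_tilted_eq]
  have h1 : StronglyMeasurable fun x => ∫ y, Real.exp ⟪y, α⟫ ∂(μ x) :=
    StronglyMeasurable.integral_kernel (Measurable.stronglyMeasurable (by fun_prop))
  have h2 : StronglyMeasurable fun x => ∫ y, Real.exp ⟪y, α⟫ • y ∂(μ x) :=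
    StronglyMeasurable.integral_kernel (Measurable.stronglyMeasurable (by fun_prop))
  exact h1.measurable.inv.smul h2.measurable

end Covariance

/-- The properties of the noise on which the limit theorem rests: expansions of the mean, variance
and relative entropy of the tilted noise for tilts of norm at most `L`, uniform in the state. -/
structure TiltExpansion {d : ℕ} (μ : Kernel (Vec d) (Vec d)) (L C : ℝ) : Prop where
  pos : 0 < L
  const_nonneg : 0 ≤ C
  covOp_le : ∀ x α : Vec d, ‖covOp μ x α‖ ≤ C * ‖α‖
  covOp_nonneg : ∀ x α : Vec d, 0 ≤ ⟪α, covOp μ x α⟫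
  measurable_mean : ∀ α : Vec d, ‖α‖ ≤ L → Measurable fun x => tiltedMean μ x α
  mean_sub_le : ∀ x α : Vec d, ‖α‖ ≤ L → ‖tiltedMean μ x α - covOp μ x α‖ ≤ C * ‖α‖ ^ 2
  univ_le : ∀ x α : Vec d, ‖α‖ ≤ L → tiltedNoise μ x α univ ≤ 1
  variance_le : ∀ x α : Vec d, ‖α‖ ≤ L → ∀ (z : Vec d) (c : ℝ),
    ∫⁻ y, ENNReal.ofReal (‖z + c • (y - tiltedMean μ x α)‖ ^ 2) ∂(tiltedNoise μ x α) ≤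
      ENNReal.ofReal (‖z‖ ^ 2 + c ^ 2 * C)
  klDiv_le : ∀ x α : Vec d, ‖α‖ ≤ L → InformationTheory.klDiv (tiltedNoise μ x α) (μ x) ≤
    ENNReal.ofReal ((1 / 2) * ⟪α, covOp μ x α⟫ + C * ‖α‖ ^ 3)

theorem MainCondition.continuous_covMatrix {d : ℕ} {b : Vec d → Vec d}
    {μ : Kernel (Vec d) (Vec d)} [IsMarkovKernel μ] (h : MainCondition b μ) :
    Continuous (covMatrix μ) := by
  obtain ⟨L, C, hL, hC⟩ := h.exists_hasExpMoment
  exact ModerateDeviations.continuous_covMatrix hC hL h.weak_continuous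

theorem MainCondition.exists_tiltExpansion {d : ℕ} {b : Vec d → Vec d}
    {μ : Kernel (Vec d) (Vec d)} [IsMarkovKernel μ] (h : MainCondition b μ) :
    ∃ L C : ℝ, TiltExpansion μ L C := by
  obtain ⟨L, C, hL, hm⟩ := h.exists_hasExpMoment
  have hC : 0 ≤ C :=
    (norm_nonneg _).trans ((hm 0).norm_integral_exp_smul_le (α := 0) (by simpa using hL.le))
  have hCL : 0 ≤ C ^ 2 * L := by positivity
  have hC2 : 0 ≤ C ^ 2 := by positivity
  refine ⟨L, 2 * C + C ^ 2 + C ^ 2 * L, hL, by positivity, ?_, ?_, ?_, ?_, ?_, ?_, ?_⟩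
  · intro x α
    rw [covOp_apply, toEuclideanLin_covMatrix (hm x) hL]
    refine ((hm x).norm_integral_inner_smul_le hL α).trans ?_
    rw [mul_comm]
    gcongr
    linarith
  · intro x α
    rw [covOp_apply, toEuclideanLin_covMatrix (hm x) hL,
      ← integral_inner ((hm x).integrable_inner_smul hL α)]
    refine integral_nonneg fun y => ?_
    simp only [Pi.zero_apply]
    rw [real_inner_smul_right, real_inner_comm]
    exact mul_self_nonneg _
  · exact fun α hα => measurable_tiltedMean hm hL hα
  · intro x α hα
    rw [covOp_apply, toEuclideanLin_covMatrix (hm x) hL, tiltedMean,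
      tiltedNoise_eq_tilted (hm x) hL hα]
    refine ((hm x).norm_integral_tilted_sub_le hL hα).trans ?_
    exact mul_le_mul_of_nonneg_right (by linarith) (sq_nonneg _)
  · intro x α hα
    rw [tiltedNoise_eq_tilted (hm x) hL hα]
    have := isProbabilityMeasure_tilted ((hm x).integrable_exp hα)
    exact prob_le_one
  · intro x α hα z c
    rw [tiltedMean, tiltedNoise_eq_tilted (hm x) hL hα]
    refine ((hm x).lintegral_tilted_sq_add_le hL hα z c).trans (ENNReal.ofReal_le_ofReal ?_)
    gcongr
    linarith
  · intro x α hα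
    rw [covOp_apply, toEuclideanLin_covMatrix (hm x) hL, tiltedNoise_eq_tilted (hm x) hL hα]
    exact (hm x).klDiv_tilted_le hL hα

/-! ### A maximal inequality for the centred noise -/

section Maximal

variable {d : ℕ}

theorem noiseAt_snoc_of_lt {m : ℕ} (v : Fin m → Vec d) (y : Vec d) {i : ℕ} (hi : i < m) :
    noiseAt (Fin.snoc v y : Fin (m + 1) → Vec d) i = noiseAt v i := by
  simp [noiseAt, hi, hi.trans (Nat.lt_succ_self m), Fin.snoc]

theorem noiseAt_snoc_self {m : ℕ} (v : Fin m → Vec d) (y : Vec d) :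
    noiseAt (Fin.snoc v y : Fin (m + 1) → Vec d) m = y := by
  simp [noiseAt, Fin.snoc]

theorem controlledX_snoc (b : Vec d → Vec d) (x₀ : Vec d) (n : ℕ) {m : ℕ} (v : Fin m → Vec d)
    (y : Vec d) {k : ℕ} (hk : k ≤ m) :
    controlledX b x₀ n (Fin.snoc v y : Fin (m + 1) → Vec d) k = controlledX b x₀ n v k := by
  induction k with
  | zero => rfl
  | succ k ih => simp only [controlledX, ih (by omega), noiseAt_snoc_of_lt v y hk]

/-- The sum of the increments `c (v_i - m_i(X̄_i))`, stopped once its norm reaches `ε`. If the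
functions `m_i` are the conditional means of the noises, this is a martingale, and its norm is at
least `ε` at the end if that of the unstopped sum is so at any time. -/
noncomputable def stoppedSum (b : Vec d → Vec d) (x₀ : Vec d) (n : ℕ) (m : ℕ → Vec d → Vec d)
    (c ε : ℝ) {M : ℕ} (v : Fin M → Vec d) : ℕ → Vec d
  | 0 => 0
  | k + 1 => stoppedSum b x₀ n m c ε v k + if ‖stoppedSum b x₀ n m c ε v k‖ < ε
      then c • (noiseAt v k - m k (controlledX b x₀ n v k)) else 0

theorem stoppedSum_snoc (b : Vec d → Vec d) (x₀ : Vec d) (n : ℕ) (m : ℕ → Vec d → Vec d)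
    (c ε : ℝ) {M : ℕ} (v : Fin M → Vec d) (y : Vec d) {k : ℕ} (hk : k ≤ M) :
    stoppedSum b x₀ n m c ε (Fin.snoc v y : Fin (M + 1) → Vec d) k =
      stoppedSum b x₀ n m c ε v k := by
  induction k with
  | zero => rfl
  | succ k ih =>
    simp only [stoppedSum, ih (by omega), noiseAt_snoc_of_lt v y hk,
      controlledX_snoc b x₀ n v y (show k ≤ M by omega)]

theorem sum_eq_stoppedSum {b : Vec d → Vec d} {x₀ : Vec d} {n : ℕ} {m : ℕ → Vec d → Vec d}
    {c ε : ℝ} {M : ℕ} {v : Fin M → Vec d} {N : ℕ} (h : ‖stoppedSum b x₀ n m c ε v N‖ < ε)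
    {k : ℕ} (hk : k ≤ N) :
    ‖stoppedSum b x₀ n m c ε v k‖ < ε ∧ stoppedSum b x₀ n m c ε v k =
      ∑ i ∈ Finset.range k, c • (noiseAt v i - m i (controlledX b x₀ n v i)) := by
  have hlt : ∀ k ≤ N, ‖stoppedSum b x₀ n m c ε v k‖ < ε := by
    intro k hk
    induction hk using Nat.decreasingInduction with
    | self => exact h
    | of_succ k _ ih =>
      by_contra hcon
      simp only [stoppedSum, hcon, if_false, add_zero] at ih
  refine ⟨hlt k hk, ?_⟩
  induction k with
  | zero => simp [stoppedSum]
  | succ k ih =>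
    rw [Finset.sum_range_succ, ← ih (by omega)]
    simp [stoppedSum, hlt k (by omega)]

theorem measurable_noiseAt {M : ℕ} (i : ℕ) : Measurable fun v : Fin M → Vec d => noiseAt v i := by
  unfold noiseAt
  split_ifs
  · exact measurable_pi_apply _
  · exact measurable_const

theorem measurable_controlledX {b : Vec d → Vec d} (hb : Measurable b) (x₀ : Vec d) (n : ℕ)
    {M : ℕ} (k : ℕ) : Measurable fun v : Fin M → Vec d => controlledX b x₀ n v k := by
  induction k with
  | zero => exact measurable_const
  | succ k ih =>
    have h1 : Measurable fun v : Fin M → Vec d => b (controlledX b x₀ n v k) := hb.comp ih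
    have h2 : Measurable fun v : Fin M → Vec d => noiseAt v k := measurable_noiseAt k
    simp only [controlledX]
    fun_prop

theorem measurable_stoppedSum {b : Vec d → Vec d} (hb : Measurable b) (x₀ : Vec d) (n : ℕ)
    {m : ℕ → Vec d → Vec d} (c ε : ℝ) {M : ℕ} {k : ℕ} (hm : ∀ i < k, Measurable (m i)) :
    Measurable fun v : Fin M → Vec d => stoppedSum b x₀ n m c ε v k := by
  induction k with
  | zero => exact measurable_const
  | succ k ih =>
    have ih' := ih fun i hi => hm i (by omega)
    have hinc : Measurable fun v : Fin M → Vec d =>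
        c • (noiseAt v k - m k (controlledX b x₀ n v k)) := by
      have h1 : Measurable fun v : Fin M → Vec d => m k (controlledX b x₀ n v k) :=
        (hm k (by omega)).comp (measurable_controlledX hb x₀ n k)
      have h2 : Measurable fun v : Fin M → Vec d => noiseAt v k := measurable_noiseAt k
      exact (h2.sub h1).const_smul c
    exact ih'.add (Measurable.ite (measurableSet_lt ih'.norm measurable_const) hinc
      measurable_const)

/-- Disintegration of the last noise. As an inequality it needs no measurability of the conditional
distributions. -/
theorem lintegral_jointLaw_succ_le (κ : (i : ℕ) → (Fin i → Vec d) → Measure (Vec d)) (m : ℕ)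
    (f : (Fin (m + 1) → Vec d) → ℝ≥0∞) :
    ∫⁻ v, f v ∂(jointLaw κ (m + 1)) ≤
      ∫⁻ v, ∫⁻ y, f (Fin.snoc v y) ∂(κ m v) ∂(jointLaw κ m) :=
  (Measure.lintegral_bind_le _ _ _).trans (lintegral_mono fun _ => lintegral_map_le _ _)

theorem jointLaw_univ_le_one {κ : (i : ℕ) → (Fin i → Vec d) → Measure (Vec d)} {N : ℕ}
    (h : ∀ i < N, ∀ v, κ i v univ ≤ 1) : jointLaw κ N univ ≤ 1 := by
  induction N with
  | zero => simp [jointLaw]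
  | succ N ih =>
    have := lintegral_jointLaw_succ_le κ N fun _ => 1
    simp only [lintegral_one] at this
    refine this.trans ((lintegral_mono fun v => h N (by omega) v).trans ?_)
    rw [lintegral_one]
    exact ih fun i hi => h i (by omega)

theorem lintegral_stoppedSum_sq_le {b : Vec d → Vec d} {x₀ : Vec d} {n : ℕ}
    {m : ℕ → Vec d → Vec d} {c ε C : ℝ} (hC : 0 ≤ C)
    {κ : (i : ℕ) → (Fin i → Vec d) → Measure (Vec d)} {N : ℕ}
    (hmass : ∀ i < N, ∀ v, κ i v univ ≤ 1)
    (hvar : ∀ i < N, ∀ (v : Fin i → Vec d) (z : Vec d),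
      ∫⁻ y, ENNReal.ofReal (‖z + c • (y - m i (controlledX b x₀ n v i))‖ ^ 2) ∂(κ i v) ≤
        ENNReal.ofReal (‖z‖ ^ 2 + c ^ 2 * C)) :
    ∫⁻ v, ENNReal.ofReal (‖stoppedSum b x₀ n m c ε v N‖ ^ 2) ∂(jointLaw κ N) ≤
      ENNReal.ofReal (N * (c ^ 2 * C)) := by
  induction N with
  | zero => simp [stoppedSum]
  | succ N ih =>
    have hc : 0 ≤ c ^ 2 * C := by positivity
    have hstep : ∀ v : Fin N → Vec d,
        ∫⁻ y, ENNReal.ofReal (‖stoppedSum b x₀ n m c ε (Fin.snoc v y : Fin (N + 1) → Vec d)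
          (N + 1)‖ ^ 2) ∂(κ N v) ≤
        ENNReal.ofReal (‖stoppedSum b x₀ n m c ε v N‖ ^ 2) + ENNReal.ofReal (c ^ 2 * C) := by
      intro v
      simp only [stoppedSum, stoppedSum_snoc b x₀ n m c ε v _ le_rfl, noiseAt_snoc_self,
        controlledX_snoc b x₀ n v _ le_rfl]
      rw [← ENNReal.ofReal_add (by positivity) hc]
      split_ifs with hlt
      · exact hvar N (by omega) v _
      · rw [add_zero, lintegral_const]
        calc _ ≤ ENNReal.ofReal (‖stoppedSum b x₀ n m c ε v N‖ ^ 2) * 1 := by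
              gcongr; exact hmass N (by omega) v
          _ ≤ _ := by rw [mul_one]; exact ENNReal.ofReal_le_ofReal (by linarith)
    refine (lintegral_jointLaw_succ_le κ N _).trans ((lintegral_mono hstep).trans ?_)
    rw [lintegral_add_right _ measurable_const, lintegral_const]
    calc _ ≤ ENNReal.ofReal (N * (c ^ 2 * C)) + ENNReal.ofReal (c ^ 2 * C) * 1 := by
          gcongr
          · exact ih (fun i hi => hmass i (by omega)) fun i hi => hvar i (by omega)
          · exact jointLaw_univ_le_one fun i hi => hmass i (by omega)
      _ = _ := by
          rw [mul_one, ← ENNReal.ofReal_add (by positivity) hc]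
          push_cast; congr 1; ring

/-- Kolmogorov's maximal inequality: the stopped sum stays below `ε` up to an event of probability
`N c² C / ε²`. -/
theorem jointLaw_stoppedSum_ge_le {b : Vec d → Vec d} {x₀ : Vec d} {n : ℕ}
    {m : ℕ → Vec d → Vec d} {c ε C : ℝ} (hC : 0 ≤ C) (hε : 0 < ε)
    {κ : (i : ℕ) → (Fin i → Vec d) → Measure (Vec d)} {N : ℕ}
    (hmass : ∀ i < N, ∀ v, κ i v univ ≤ 1)
    (hvar : ∀ i < N, ∀ (v : Fin i → Vec d) (z : Vec d),
      ∫⁻ y, ENNReal.ofReal (‖z + c • (y - m i (controlledX b x₀ n v i))‖ ^ 2) ∂(κ i v) ≤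
        ENNReal.ofReal (‖z‖ ^ 2 + c ^ 2 * C))
    (hb : Measurable b) (hm : ∀ i < N, Measurable (m i)) :
    jointLaw κ N {v | ε ≤ ‖stoppedSum b x₀ n m c ε v N‖} ≤
      ENNReal.ofReal (N * (c ^ 2 * C) / ε ^ 2) := by
  have hmeas : Measurable fun v : Fin N → Vec d =>
      ENNReal.ofReal (‖stoppedSum b x₀ n m c ε v N‖ ^ 2) :=
    ((measurable_stoppedSum hb x₀ n c ε hm).norm.pow_const 2).ennreal_ofReal
  have hsub : {v : Fin N → Vec d | ε ≤ ‖stoppedSum b x₀ n m c ε v N‖} ⊆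
      {v | ENNReal.ofReal (ε ^ 2) ≤ ENNReal.ofReal (‖stoppedSum b x₀ n m c ε v N‖ ^ 2)} :=
    fun v (hv : ε ≤ _) => ENNReal.ofReal_le_ofReal (pow_le_pow_left₀ hε.le hv 2)
  refine (measure_mono hsub).trans ((meas_ge_le_lintegral_div hmeas.aemeasurable
    (by simpa using hε.ne') ENNReal.ofReal_ne_top).trans ?_)
  rw [ENNReal.ofReal_div_of_pos (by positivity)]
  gcongr
  exact lintegral_stoppedSum_sq_le hC hmass hvar

end Maximal

/-! ### Riemann sums, a discrete Gronwall inequality, and interpolation -/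

theorem natCast_div_mem_Icc {k n : ℕ} (hk : k ≤ n) : (k : ℝ) / n ∈ Icc (0 : ℝ) 1 :=
  ⟨by positivity, div_le_one_of_le₀ (by exact_mod_cast hk) (by positivity)⟩

theorem le_mul_exp_of_le_add_sum {e : ℕ → ℝ} {c L : ℝ} (hc : 0 ≤ c) (hL : 0 ≤ L) {n : ℕ}
    (h : ∀ k ≤ n, e k ≤ c + ∑ i ∈ Finset.range k, (1 / (n : ℝ)) * (L * e i)) {k : ℕ}
    (hk : k ≤ n) : e k ≤ c * Real.exp L := by
  have hLn : 0 ≤ L / n := by positivity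
  have key : ∀ k ≤ n, e k ≤ c * (1 + L / n) ^ k := by
    intro k
    induction k using Nat.strong_induction_on with
    | _ k ih =>
      intro hk
      refine (h k hk).trans ?_
      have hsum : ∀ k : ℕ, c + ∑ i ∈ Finset.range k, (1 / (n : ℝ)) * (L * (c * (1 + L / n) ^ i)) =
          c * (1 + L / n) ^ k := by
        intro k
        induction k with
        | zero => simp
        | succ k ih => rw [Finset.sum_range_succ, ← add_assoc, ih, pow_succ]; ring
      rw [← hsum k]
      gcongr with i hi
      have hik := Finset.mem_range.1 hi
      exact ih i hik (hik.le.trans hk)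
  refine (key k hk).trans ?_
  gcongr
  calc (1 + L / n) ^ k ≤ Real.exp (L / n) ^ k := by
        gcongr; rw [add_comm]; exact Real.add_one_le_exp _
    _ = Real.exp (L * (k / n)) := by rw [← Real.exp_nat_mul]; ring_nf
    _ ≤ Real.exp L := by
        refine Real.exp_le_exp.2 ?_
        exact mul_le_of_le_one_right hL (natCast_div_mem_Icc hk).2

/-- The primitive of a continuous function is approximated by left Riemann sums with mesh `1/n`,
uniformly in the upper limit. -/
theorem eventually_riemannSum_sub_le {E : Type*} [NormedAddCommGroup E] [NormedSpace ℝ E]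
    [CompleteSpace E] {g : ℝ → E} (hg : ContinuousOn g (Icc 0 1)) {η : ℝ} (hη : 0 < η) :
    ∀ᶠ n : ℕ in atTop, ∀ k ≤ n, ‖∑ i ∈ Finset.range k, (1 / (n : ℝ)) • g (i / n) -
      ∫ s in (0 : ℝ)..(k / n), g s‖ ≤ η := by
  have huc := isCompact_Icc.uniformContinuousOn_of_continuous hg
  obtain ⟨δ, hδ, hgδ⟩ := Metric.uniformContinuousOn_iff.1 huc η hη
  obtain ⟨N, hN⟩ := exists_nat_one_div_lt hδ
  filter_upwards [eventually_gt_atTop N] with n hn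
  have hn0 : (0 : ℝ) < n := by exact_mod_cast (Nat.zero_le N).trans_lt hn
  have hnδ : 1 / (n : ℝ) < δ := by
    refine lt_of_le_of_lt ?_ hN
    gcongr
    exact_mod_cast hn
  have hstep : ∀ k ≤ n, ‖∑ i ∈ Finset.range k, (1 / (n : ℝ)) • g (i / n) -
      ∫ s in (0 : ℝ)..(k / n), g s‖ ≤ k / n * η := by
    intro k
    induction k with
    | zero => simp
    | succ k ih =>
      intro hk
      have h0 := natCast_div_mem_Icc (show k ≤ n by omega)
      have h1 := natCast_div_mem_Icc hk
      have hle : (k : ℝ) / n ≤ ((k + 1 : ℕ) : ℝ) / n := by gcongr; simp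
      have hlen : ((k + 1 : ℕ) : ℝ) / n - k / n = 1 / n := by push_cast; ring
      have hi1 : IntervalIntegrable g volume 0 (k / n) := by
        refine (hg.mono ?_).intervalIntegrable
        rw [uIcc_of_le h0.1]; exact Icc_subset_Icc le_rfl h0.2
      have hsub : uIcc ((k : ℝ) / n) (((k + 1 : ℕ) : ℝ) / n) ⊆ Icc 0 1 := by
        rw [uIcc_of_le hle]; exact Icc_subset_Icc h0.1 h1.2
      have hi2 : IntervalIntegrable g volume (k / n) ((k + 1 : ℕ) / n) :=
        (hg.mono hsub).intervalIntegrable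
      rw [Finset.sum_range_succ, ← intervalIntegral.integral_add_adjacent_intervals hi1 hi2]
      have hpiece : ‖(1 / (n : ℝ)) • g (k / n) - ∫ s in ((k : ℝ) / n)..((k + 1 : ℕ) / n), g s‖ ≤
          η * (1 / n) := by
        have e : (1 / (n : ℝ)) • g (k / n) - ∫ s in ((k : ℝ) / n)..((k + 1 : ℕ) / n), g s =
            ∫ s in ((k : ℝ) / n)..((k + 1 : ℕ) / n), (g (k / n) - g s) := by
          rw [intervalIntegral.integral_sub (by simp) hi2, intervalIntegral.integral_const, hlen]
        rw [e]
        have := intervalIntegral.norm_integral_le_of_norm_le_const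
          (a := (k : ℝ) / n) (b := ((k + 1 : ℕ) : ℝ) / n) (C := η)
          (f := fun s => g (k / n) - g s) fun s hs => ?_
        · rwa [hlen, abs_of_pos (by positivity)] at this
        · rw [uIoc_of_le hle] at hs
          rw [← dist_eq_norm]
          refine (hgδ _ h0 _ ⟨h0.1.trans hs.1.le, hs.2.trans h1.2⟩ ?_).le
          rw [dist_comm, Real.dist_eq, abs_of_pos (by linarith [hs.1])]
          linarith [hs.2]
      have e : ∀ p q r t : E, p + q - (r + t) = (p - r) + (q - t) := fun p q r t => by abel
      rw [e]
      refine (norm_add_le _ _).trans ((add_le_add (ih (by omega)) hpiece).trans_eq ?_)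
      push_cast; ring
  intro k hk
  refine (hstep k hk).trans ?_
  exact mul_le_of_le_one_left hη.le (natCast_div_mem_Icc hk).2

/-- A continuous function is uniformly continuous at the points of a compact curve. -/
theorem exists_norm_sub_le_of_near_path {E F : Type*} [NormedAddCommGroup E] [NormedAddCommGroup F]
    {f : E → F} (hf : Continuous f) {X : ℝ → E} (hX : ContinuousOn X (Icc 0 1)) {η : ℝ}
    (hη : 0 < η) : ∃ δ > 0, ∀ s ∈ Icc (0 : ℝ) 1, ∀ z, ‖z - X s‖ ≤ δ → ‖f z - f (X s)‖ ≤ η := by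
  have h := (isCompact_Icc.image_of_continuousOn hX).uniformContinuousAt_of_continuousAt f
    (fun _ _ => hf.continuousAt) (Metric.dist_mem_uniformity hη)
  obtain ⟨δ, hδ, hδ'⟩ := Metric.mem_uniformity_dist.1 h
  refine ⟨δ / 2, by positivity, fun s hs z hz => ?_⟩
  have h1 : dist (X s) z < δ := by rw [dist_comm, dist_eq_norm]; linarith
  have h2 : dist (f (X s)) (f z) < η := hδ' h1 (mem_image_of_mem X hs)
  rw [← dist_eq_norm, dist_comm]
  exact h2.le

theorem norm_interpolate_sub_le {d : ℕ} {n : ℕ} (hn : 0 < n) {y : ℕ → Vec d} {φ : ℝ → Vec d}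
    {η : ℝ} (hy : ∀ k ≤ n, ‖y k - φ (k / n)‖ ≤ η)
    (hφ : ∀ s ∈ Icc (0 : ℝ) 1, ∀ t ∈ Icc (0 : ℝ) 1, |s - t| ≤ 1 / n → ‖φ s - φ t‖ ≤ η)
    {t : ℝ} (ht : t ∈ Icc (0 : ℝ) 1) : ‖interpolate n y t - φ t‖ ≤ 2 * η := by
  have hn0 : (0 : ℝ) < n := by exact_mod_cast hn
  have hnt : 0 ≤ n * t := mul_nonneg hn0.le ht.1
  have hfl := Nat.floor_le hnt
  have hfl' := Nat.lt_floor_add_one (n * t)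
  have hflle : ⌊(n : ℝ) * t⌋₊ ≤ n := by
    have : (⌊(n : ℝ) * t⌋₊ : ℝ) ≤ n := hfl.trans (by nlinarith [ht.2])
    exact_mod_cast this
  unfold interpolate
  set i := ⌊(n : ℝ) * t⌋₊
  have hclose : ∀ j ≤ n, |(j : ℝ) - n * t| ≤ 1 → ‖y j - φ t‖ ≤ 2 * η := by
    intro j hj hjt
    have h1 : |(j : ℝ) / n - t| ≤ 1 / n := by
      have : (j : ℝ) / n - t = (j - n * t) / n := by field_simp
      rw [this, abs_div, abs_of_pos hn0]
      gcongr
    have := norm_sub_le_norm_sub_add_norm_sub (y j) (φ (j / n)) (φ t)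
    linarith [hy j hj, hφ _ (natCast_div_mem_Icc hj) _ ht h1]
  have e : ((i : ℝ) + 1 - n * t) • y i + (n * t - (i : ℝ)) • y (i + 1) - φ t =
      ((i : ℝ) + 1 - n * t) • (y i - φ t) + (n * t - (i : ℝ)) • (y (i + 1) - φ t) := by
    simp only [smul_sub, sub_smul, add_smul, one_smul]; abel
  rw [e]
  have h1 : ‖((i : ℝ) + 1 - n * t) • (y i - φ t)‖ ≤ ((i : ℝ) + 1 - n * t) * (2 * η) := by
    rw [norm_smul, Real.norm_eq_abs, abs_of_pos (by linarith)]
    refine mul_le_mul_of_nonneg_left (hclose i hflle ?_) (by linarith)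
    rw [abs_le]; constructor <;> linarith
  have h2 : ‖(n * t - (i : ℝ)) • (y (i + 1) - φ t)‖ ≤ (n * t - (i : ℝ)) * (2 * η) := by
    rw [norm_smul, Real.norm_eq_abs, abs_of_nonneg (by linarith)]
    rcases hflle.eq_or_lt with hi | hi
    · -- the node beyond the endpoint carries no weight
      have : n * t - (i : ℝ) = 0 := by
        rw [hi] at hfl ⊢
        nlinarith [ht.2]
      rw [this]; simp
    · refine mul_le_mul_of_nonneg_left (hclose (i + 1) hi ?_) (by linarith)
      push_cast
      rw [abs_le]; constructor <;> linarith
  calc _ ≤ _ := norm_add_le _ _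
    _ ≤ ((i : ℝ) + 1 - n * t) * (2 * η) + (n * t - (i : ℝ)) * (2 * η) := add_le_add h1 h2
    _ = 2 * η := by ring

/-! ### The noiseless recursion -/

section Noiseless

variable {d : ℕ} {b : Vec d → Vec d} {Kb : ℝ}

theorem norm_drift_sub_le (hb : ContDiff ℝ 1 b) (hKb : ∀ x, ‖fderiv ℝ b x‖ ≤ Kb) (x y : Vec d) :
    ‖b x - b y‖ ≤ Kb * ‖x - y‖ :=
  Convex.norm_image_sub_le_of_norm_fderiv_le
    (fun _ _ => (hb.differentiable one_ne_zero).differentiableAt) (fun z _ => hKb z) convex_univ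
    (mem_univ y) (mem_univ x)

/-- The Euler scheme converges to the law of large numbers limit, uniformly on `[0, 1]`. -/
theorem eventually_norm_noiselessX_sub_le (hb : ContDiff ℝ 1 b)
    (hKb : ∀ x, ‖fderiv ℝ b x‖ ≤ Kb) {x₀ : Vec d} {X0 : ℝ → Vec d} (hX0 : IsLLNLimit b x₀ X0)
    {η : ℝ} (hη : 0 < η) :
    ∀ᶠ n : ℕ in atTop, ∀ k ≤ n, ‖noiselessX b x₀ n k - X0 (k / n)‖ ≤ η := by
  have hKb0 : 0 ≤ Kb := (norm_nonneg _).trans (hKb 0)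
  have hg : ContinuousOn (fun s => b (X0 s)) (Icc 0 1) := hb.continuous.comp_continuousOn hX0.1
  filter_upwards [eventually_riemannSum_sub_le hg (show 0 < η * Real.exp (-Kb) by positivity)]
    with n hn k hk
  have hsum : ∀ k, noiselessX b x₀ n k =
      x₀ + ∑ i ∈ Finset.range k, (1 / (n : ℝ)) • b (noiselessX b x₀ n i) := by
    intro k
    induction k with
    | zero => simp [noiselessX]
    | succ k ih => rw [Finset.sum_range_succ, ← add_assoc, ← ih, noiselessX]
  have := le_mul_exp_of_le_add_sum (e := fun k => ‖noiselessX b x₀ n k - X0 (k / n)‖)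
    (show 0 ≤ η * Real.exp (-Kb) by positivity) hKb0 (n := n) (fun k hk => ?_) hk
  · rwa [mul_assoc, ← Real.exp_add, neg_add_cancel, Real.exp_zero, mul_one] at this
  · have e : noiselessX b x₀ n k - X0 (k / n) =
        (∑ i ∈ Finset.range k, (1 / (n : ℝ)) • b (X0 (i / n)) - ∫ s in (0 : ℝ)..(k / n), b (X0 s)) +
        ∑ i ∈ Finset.range k, (1 / (n : ℝ)) • (b (noiselessX b x₀ n i) - b (X0 (i / n))) := by
      rw [hsum k, hX0.2 _ (natCast_div_mem_Icc hk)]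
      simp only [smul_sub, Finset.sum_sub_distrib]
      abel
    rw [e]
    refine (norm_add_le _ _).trans (add_le_add (hn k hk) ?_)
    refine (norm_sum_le _ _).trans (Finset.sum_le_sum fun i _ => ?_)
    rw [norm_smul, Real.norm_of_nonneg (by positivity)]
    gcongr
    exact norm_drift_sub_le hb hKb _ _

end Noiseless

/-! ### The controlled recursion on the event that the centred noise is small -/

section Controlled

variable {d : ℕ} {b : Vec d → Vec d} {μ : Kernel (Vec d) (Vec d)} {x₀ : Vec d} {a : ℕ → ℝ}
  {X0 u : ℝ → Vec d} {K Kb L C W θ δ : ℝ} {φ : ℝ → Vec d} {n : ℕ}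

/-- The tilt parameter `α_i^n` of the `i`-th noise. -/
noncomputable def controlTilt (μ : Kernel (Vec d) (Vec d)) (a : ℕ → ℝ) (X0 u : ℝ → Vec d) (K : ℝ)
    (n i : ℕ) : Vec d :=
  (1 / (a n * √(n : ℝ))) • tiltDirection μ X0 u K ((i : ℝ) / n)

theorem norm_controlTilt_le (hs : 0 < a n * √(n : ℝ))
    (hW : ∀ s ∈ Icc (0 : ℝ) 1, ‖tiltDirection μ X0 u K s‖ ≤ W) {i : ℕ} (hi : i ≤ n) :
    ‖controlTilt μ a X0 u K n i‖ ≤ W / (a n * √(n : ℝ)) := by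
  rw [controlTilt, norm_smul, Real.norm_of_nonneg (by positivity), div_mul_eq_mul_div, one_mul]
  gcongr
  exact hW _ (natCast_div_mem_Icc hi)

/-- Rescaling by `a(n)√n` turns the tilted mean into the covariance applied to the control
direction, up to an error of order `1/(a(n)√n)`. -/
theorem norm_smul_tiltedMean_sub_le (hμ : TiltExpansion μ L C) (hs : 0 < a n * √(n : ℝ))
    (hW : ∀ s ∈ Icc (0 : ℝ) 1, ‖tiltDirection μ X0 u K s‖ ≤ W) (hWs : W / (a n * √(n : ℝ)) ≤ L)
    {i : ℕ} (hi : i ≤ n) (x : Vec d) :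
    ‖(a n * √(n : ℝ)) • tiltedMean μ x (controlTilt μ a X0 u K n i) -
      covOp μ x (tiltDirection μ X0 u K (i / n))‖ ≤ C * W ^ 2 / (a n * √(n : ℝ)) := by
  have hα := norm_controlTilt_le hs hW hi
  have hW0 : 0 ≤ W := (norm_nonneg _).trans (hW 0 (by simp))
  have e : covOp μ x (tiltDirection μ X0 u K (i / n)) =
      (a n * √(n : ℝ)) • covOp μ x (controlTilt μ a X0 u K n i) := by
    rw [controlTilt, map_smul, smul_smul, mul_one_div_cancel hs.ne', one_smul]
  rw [e, ← smul_sub, norm_smul, Real.norm_of_nonneg hs.le]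
  set s := a n * √(n : ℝ)
  have hC := hμ.const_nonneg
  calc s * ‖tiltedMean μ x (controlTilt μ a X0 u K n i) - covOp μ x (controlTilt μ a X0 u K n i)‖
      ≤ s * (C * (W / s) ^ 2) := by
        gcongr
        refine (hμ.mean_sub_le x _ (hα.trans hWs)).trans ?_
        gcongr
    _ = C * W ^ 2 / s := by field_simp

/-- The normalized sum of the first `k` noises, each centred at its conditional mean. -/
noncomputable def centredSum (b : Vec d → Vec d) (μ : Kernel (Vec d) (Vec d)) (x₀ : Vec d)
    (a : ℕ → ℝ) (X0 u : ℝ → Vec d) (K : ℝ) (n : ℕ) (v : Fin n → Vec d) (k : ℕ) : Vec d :=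
  ∑ i ∈ Finset.range k, (a n / √(n : ℝ)) •
    (noiseAt v i - tiltedMean μ (controlledX b x₀ n v i) (controlTilt μ a X0 u K n i))

theorem div_sqrt_eq (hn : 0 < n) (r : ℝ) : r / √(n : ℝ) = (1 / (n : ℝ)) * (r * √(n : ℝ)) := by
  have h : √(n : ℝ) ≠ 0 := (Real.sqrt_pos.2 (by exact_mod_cast hn)).ne'
  have h2 : √(n : ℝ) * √(n : ℝ) = n := Real.mul_self_sqrt (by positivity)
  rw [one_div_mul_eq_div, div_eq_div_iff h (by exact_mod_cast hn.ne'), mul_assoc, h2]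

/-- `Ȳ` is the rescaled difference of the controlled and the noiseless recursion. -/
theorem controlledX_eq (hn : 0 < n) (hs : 0 < a n * √(n : ℝ)) (v : Fin n → Vec d) (k : ℕ) :
    controlledX b x₀ n v k =
      noiselessX b x₀ n k + (1 / (a n * √(n : ℝ))) • controlledY b x₀ a n v k := by
  induction k with
  | zero => simp [controlledX, noiselessX, controlledY]
  | succ k ih =>
    have hc : 1 / (a n * √(n : ℝ)) * (a n / √(n : ℝ)) = 1 / n := by
      rw [div_sqrt_eq hn, mul_comm (1 / (n : ℝ)), ← mul_assoc, one_div_mul_cancel hs.ne', one_mul]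
    rw [controlledX, noiselessX, controlledY, smul_add, smul_add, smul_smul, smul_smul, hc,
      smul_sub]
    nth_rewrite 1 [ih]
    abel

theorem controlledY_eq_sum (hn : 0 < n) (v : Fin n → Vec d) (k : ℕ) :
    controlledY b x₀ a n v k =
      ∑ i ∈ Finset.range k, (1 / (n : ℝ)) • ((a n * √(n : ℝ)) •
          (b (controlledX b x₀ n v i) - b (noiselessX b x₀ n i))) +
      ∑ i ∈ Finset.range k, (1 / (n : ℝ)) • ((a n * √(n : ℝ)) •
          tiltedMean μ (controlledX b x₀ n v i) (controlTilt μ a X0 u K n i)) +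
      centredSum b μ x₀ a X0 u K n v k := by
  unfold centredSum
  induction k with
  | zero => simp [controlledY]
  | succ k ih =>
    rw [controlledY, ih, Finset.sum_range_succ, Finset.sum_range_succ, Finset.sum_range_succ,
      div_sqrt_eq hn, smul_smul, smul_smul]
    simp only [smul_sub]
    abel

theorem norm_smul_drift_sub_le (hb : ContDiff ℝ 1 b) (hKb : ∀ x, ‖fderiv ℝ b x‖ ≤ Kb)
    (hn : 0 < n) (hs : 0 < a n * √(n : ℝ)) (v : Fin n → Vec d) (i : ℕ) :
    ‖(a n * √(n : ℝ)) • (b (controlledX b x₀ n v i) - b (noiselessX b x₀ n i))‖ ≤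
      Kb * ‖controlledY b x₀ a n v i‖ := by
  have h := norm_drift_sub_le hb hKb (controlledX b x₀ n v i) (noiselessX b x₀ n i)
  rw [norm_smul, Real.norm_of_nonneg hs.le]
  have e : controlledX b x₀ n v i - noiselessX b x₀ n i =
      (1 / (a n * √(n : ℝ))) • controlledY b x₀ a n v i := by
    rw [controlledX_eq hn hs]; abel
  rw [e, norm_smul, Real.norm_of_nonneg (by positivity)] at h
  calc _ ≤ (a n * √(n : ℝ)) * (Kb * (1 / (a n * √(n : ℝ)) * ‖controlledY b x₀ a n v i‖)) := by
        gcongr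
    _ = _ := by
        have h0 := hs.ne'
        generalize a n * √(n : ℝ) = s at h0 ⊢
        field_simp

theorem norm_controlledY_le (hb : ContDiff ℝ 1 b) (hKb : ∀ x, ‖fderiv ℝ b x‖ ≤ Kb)
    (hμ : TiltExpansion μ L C) (hn : 0 < n) (hs : 0 < a n * √(n : ℝ))
    (hW : ∀ s ∈ Icc (0 : ℝ) 1, ‖tiltDirection μ X0 u K s‖ ≤ W) (hWs : W / (a n * √(n : ℝ)) ≤ L)
    (hWs' : C * W ^ 2 / (a n * √(n : ℝ)) ≤ 1) {v : Fin n → Vec d}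
    (hM : ∀ k ≤ n, ‖centredSum b μ x₀ a X0 u K n v k‖ ≤ 1) {k : ℕ} (hk : k ≤ n) :
    ‖controlledY b x₀ a n v k‖ ≤ (C * W + 2) * Real.exp Kb := by
  have hKb0 : 0 ≤ Kb := (norm_nonneg _).trans (hKb 0)
  have hW0 : 0 ≤ W := (norm_nonneg _).trans (hW 0 (by simp))
  have hC := hμ.const_nonneg
  refine le_mul_exp_of_le_add_sum (e := fun k => ‖controlledY b x₀ a n v k‖) (by positivity) hKb0
    (fun k hk => ?_) hk
  rw [controlledY_eq_sum (μ := μ) (X0 := X0) (u := u) (K := K) hn]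
  refine (norm_add₃_le ..).trans ?_
  have h1 : ‖∑ i ∈ Finset.range k, (1 / (n : ℝ)) • ((a n * √(n : ℝ)) •
      (b (controlledX b x₀ n v i) - b (noiselessX b x₀ n i)))‖ ≤
      ∑ i ∈ Finset.range k, (1 / (n : ℝ)) * (Kb * ‖controlledY b x₀ a n v i‖) := by
    refine (norm_sum_le _ _).trans (Finset.sum_le_sum fun i _ => ?_)
    rw [norm_smul, Real.norm_of_nonneg (by positivity)]
    gcongr
    exact norm_smul_drift_sub_le hb hKb hn hs v i
  have h2 : ‖∑ i ∈ Finset.range k, (1 / (n : ℝ)) • ((a n * √(n : ℝ)) •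
      tiltedMean μ (controlledX b x₀ n v i) (controlTilt μ a X0 u K n i))‖ ≤ C * W + 1 := by
    have hterm : ∀ i ∈ Finset.range k, ‖(1 / (n : ℝ)) • ((a n * √(n : ℝ)) •
        tiltedMean μ (controlledX b x₀ n v i) (controlTilt μ a X0 u K n i))‖ ≤
        (1 / (n : ℝ)) * (C * W + 1) := by
      intro i hi
      have hin : i ≤ n := (Finset.mem_range.1 hi).le.trans hk
      rw [norm_smul, Real.norm_of_nonneg (by positivity)]
      gcongr
      have h3 := norm_smul_tiltedMean_sub_le hμ hs hW hWs hin (controlledX b x₀ n v i)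
      have h4 := hμ.covOp_le (controlledX b x₀ n v i) (tiltDirection μ X0 u K (i / n))
      have h5 := mul_le_mul_of_nonneg_left (hW _ (natCast_div_mem_Icc hin)) hC
      have h6 := norm_le_norm_add_norm_sub' ((a n * √(n : ℝ)) •
        tiltedMean μ (controlledX b x₀ n v i) (controlTilt μ a X0 u K n i))
        (covOp μ (controlledX b x₀ n v i) (tiltDirection μ X0 u K (i / n)))
      linarith
    refine (norm_sum_le _ _).trans ((Finset.sum_le_sum hterm).trans ?_)
    rw [Finset.sum_const, Finset.card_range, nsmul_eq_mul, ← mul_assoc, mul_one_div]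
    exact mul_le_of_le_one_left (by positivity) (natCast_div_mem_Icc hk).2
  linarith [hM k hk]

theorem norm_controlledX_sub_le (hn : 0 < n) (hs : 0 < a n * √(n : ℝ)) {v : Fin n → Vec d}
    {B : ℝ} {k : ℕ} (hY : ‖controlledY b x₀ a n v k‖ ≤ B) (hB : B / (a n * √(n : ℝ)) ≤ δ)
    (hX : ‖noiselessX b x₀ n k - X0 (k / n)‖ ≤ δ) :
    ‖controlledX b x₀ n v k - X0 (k / n)‖ ≤ 2 * δ := by
  rw [controlledX_eq hn hs, add_sub_right_comm]
  refine (norm_add_le _ _).trans ?_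
  rw [norm_smul, Real.norm_of_nonneg (by positivity)]
  have : 1 / (a n * √(n : ℝ)) * ‖controlledY b x₀ a n v k‖ ≤ B / (a n * √(n : ℝ)) := by
    rw [div_mul_eq_mul_div, one_mul]; gcongr
  linarith

/-- The rescaled increment of the drift is the derivative along the limit applied to `Ȳ`, up to the
oscillation of the derivative. -/
theorem norm_smul_drift_sub_fderiv_le (hb : ContDiff ℝ 1 b) (hn : 0 < n)
    (hs : 0 < a n * √(n : ℝ)) (v : Fin n → Vec d) {i : ℕ} {z : Vec d}
    (hD : ∀ x, ‖x - z‖ ≤ δ → ‖fderiv ℝ b x - fderiv ℝ b z‖ ≤ θ)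
    (hX : ‖controlledX b x₀ n v i - z‖ ≤ δ) (hXn : ‖noiselessX b x₀ n i - z‖ ≤ δ) :
    ‖(a n * √(n : ℝ)) • (b (controlledX b x₀ n v i) - b (noiselessX b x₀ n i)) -
      fderiv ℝ b z (controlledY b x₀ a n v i)‖ ≤ θ * ‖controlledY b x₀ a n v i‖ := by
  have h := Convex.norm_image_sub_le_of_norm_fderiv_le' (𝕜 := ℝ) (f := b)
    (φ := fderiv ℝ b z) (s := Metric.closedBall z δ) (C := θ)
    (fun x _ => (hb.differentiable one_ne_zero).differentiableAt)
    (fun x hx => hD x (by simpa [dist_eq_norm] using hx)) (convex_closedBall z δ)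
    (x := noiselessX b x₀ n i) (y := controlledX b x₀ n v i) (by simpa [dist_eq_norm] using hXn)
    (by simpa [dist_eq_norm] using hX)
  have e : controlledX b x₀ n v i - noiselessX b x₀ n i =
      (1 / (a n * √(n : ℝ))) • controlledY b x₀ a n v i := by
    rw [controlledX_eq hn hs]; abel
  have e2 : fderiv ℝ b z (controlledY b x₀ a n v i) = (a n * √(n : ℝ)) •
      fderiv ℝ b z (controlledX b x₀ n v i - noiselessX b x₀ n i) := by
    rw [e, map_smul, smul_smul, mul_one_div_cancel hs.ne', one_smul]
  rw [e2, ← smul_sub, norm_smul, Real.norm_of_nonneg hs.le]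
  rw [e, norm_smul, Real.norm_of_nonneg (by positivity), ← e] at h
  calc _ ≤ (a n * √(n : ℝ)) * (θ * (1 / (a n * √(n : ℝ)) * ‖controlledY b x₀ a n v i‖)) := by
        gcongr
    _ = _ := by
        have h0 := hs.ne'
        generalize a n * √(n : ℝ) = s at h0 ⊢
        field_simp

/-- The comparison of `Ȳ` with its limit at the grid points: each source of error is at most `θ`. -/
theorem norm_controlledY_sub_le (hb : ContDiff ℝ 1 b) (hKb : ∀ x, ‖fderiv ℝ b x‖ ≤ Kb)
    (hμ : TiltExpansion μ L C) (hn : 0 < n) (hs : 0 < a n * √(n : ℝ))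
    (hW : ∀ s ∈ Icc (0 : ℝ) 1, ‖tiltDirection μ X0 u K s‖ ≤ W) (hWs : W / (a n * √(n : ℝ)) ≤ L)
    (hWs' : C * W ^ 2 / (a n * √(n : ℝ)) ≤ θ) (hθ : 0 ≤ θ)
    (hD : ∀ s ∈ Icc (0 : ℝ) 1, ∀ x, ‖x - X0 s‖ ≤ δ → ‖fderiv ℝ b x - fderiv ℝ b (X0 s)‖ ≤ θ)
    (hA : ∀ s ∈ Icc (0 : ℝ) 1, ∀ x, ‖x - X0 s‖ ≤ δ → ‖covOp μ x - covOp μ (X0 s)‖ ≤ θ)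
    (hφ : IsControlledLimit b μ X0 u K φ)
    (hR1 : ∀ k ≤ n, ‖∑ i ∈ Finset.range k, (1 / (n : ℝ)) •
      fderiv ℝ b (X0 ((i : ℝ) / n)) (φ ((i : ℝ) / n)) -
      ∫ s in (0 : ℝ)..(k / n), fderiv ℝ b (X0 s) (φ s)‖ ≤ θ)
    (hR2 : ∀ k ≤ n, ‖∑ i ∈ Finset.range k, (1 / (n : ℝ)) •
      covOp μ (X0 ((i : ℝ) / n)) (tiltDirection μ X0 u K ((i : ℝ) / n)) -
      ∫ s in (0 : ℝ)..(k / n), covOp μ (X0 s) (tiltDirection μ X0 u K s)‖ ≤ θ)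
    {v : Fin n → Vec d} {B : ℝ} (hB0 : 0 ≤ B)
    (hM : ∀ k ≤ n, ‖centredSum b μ x₀ a X0 u K n v k‖ ≤ θ)
    (hY : ∀ k ≤ n, ‖controlledY b x₀ a n v k‖ ≤ B)
    (hXn : ∀ k ≤ n, ‖noiselessX b x₀ n k - X0 (k / n)‖ ≤ δ)
    (hX : ∀ k ≤ n, ‖controlledX b x₀ n v k - X0 (k / n)‖ ≤ δ) {k : ℕ} (hk : k ≤ n) :
    ‖controlledY b x₀ a n v k - φ (k / n)‖ ≤ (θ * (B + W + 4)) * Real.exp Kb := by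
  have hKb0 : 0 ≤ Kb := (norm_nonneg _).trans (hKb 0)
  have hW0 : 0 ≤ W := (norm_nonneg _).trans (hW 0 (by simp))
  have hC := hμ.const_nonneg
  refine le_mul_exp_of_le_add_sum (e := fun k => ‖controlledY b x₀ a n v k - φ (k / n)‖)
    (by positivity) hKb0 (fun k hk => ?_) hk
  set f : ℕ → Vec d := fun i => (a n * √(n : ℝ)) •
    (b (controlledX b x₀ n v i) - b (noiselessX b x₀ n i))
  set g : ℕ → Vec d := fun i => (a n * √(n : ℝ)) •
    tiltedMean μ (controlledX b x₀ n v i) (controlTilt μ a X0 u K n i)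
  set D : ℕ → Vec d →L[ℝ] Vec d := fun i => fderiv ℝ b (X0 ((i : ℝ) / n))
  set w : ℕ → Vec d := fun i => tiltDirection μ X0 u K ((i : ℝ) / n)
  set A : ℕ → Vec d →L[ℝ] Vec d := fun i => covOp μ (X0 ((i : ℝ) / n))
  have hφk : φ (k / n) = (∫ s in (0 : ℝ)..(k / n), fderiv ℝ b (X0 s) (φ s)) +
      ∫ s in (0 : ℝ)..(k / n), covOp μ (X0 s) (tiltDirection μ X0 u K s) :=
    hφ.2 _ (natCast_div_mem_Icc hk)
  have e : controlledY b x₀ a n v k - φ (k / n) =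
      (∑ i ∈ Finset.range k, (1 / (n : ℝ)) • ((f i - D i (controlledY b x₀ a n v i)) +
          (g i - A i (w i)) + D i (controlledY b x₀ a n v i - φ (i / n)))) +
      (∑ i ∈ Finset.range k, (1 / (n : ℝ)) • D i (φ (i / n)) -
        ∫ s in (0 : ℝ)..(k / n), fderiv ℝ b (X0 s) (φ s)) +
      (∑ i ∈ Finset.range k, (1 / (n : ℝ)) • A i (w i) -
        ∫ s in (0 : ℝ)..(k / n), covOp μ (X0 s) (tiltDirection μ X0 u K s)) +
      centredSum b μ x₀ a X0 u K n v k := by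
    rw [hφk]
    nth_rewrite 1 [controlledY_eq_sum (μ := μ) (X0 := X0) (u := u) (K := K) hn]
    simp only [map_sub, smul_add, smul_sub, Finset.sum_add_distrib, Finset.sum_sub_distrib, f, g]
    abel
  have hterm : ∀ i ∈ Finset.range k, ‖(1 / (n : ℝ)) • ((f i - D i (controlledY b x₀ a n v i)) +
      (g i - A i (w i)) + D i (controlledY b x₀ a n v i - φ (i / n)))‖ ≤
      (1 / (n : ℝ)) * (θ * (B + W + 1)) +
        (1 / (n : ℝ)) * (Kb * ‖controlledY b x₀ a n v i - φ (i / n)‖) := by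
    intro i hi
    have hin : i ≤ n := (Finset.mem_range.1 hi).le.trans hk
    have hI := natCast_div_mem_Icc hin
    rw [norm_smul, Real.norm_of_nonneg (by positivity), ← mul_add]
    gcongr
    have t1 : ‖f i - D i (controlledY b x₀ a n v i)‖ ≤ θ * B :=
      (norm_smul_drift_sub_fderiv_le hb hn hs v (hD _ hI) (hX i hin) (hXn i hin)).trans
        (mul_le_mul_of_nonneg_left (hY i hin) hθ)
    have t2 : ‖g i - A i (w i)‖ ≤ θ + θ * W := by
      have h1 := norm_smul_tiltedMean_sub_le hμ hs hW hWs hin (controlledX b x₀ n v i)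
      have h2 : ‖covOp μ (controlledX b x₀ n v i) (w i) - A i (w i)‖ ≤ θ * W := by
        rw [← sub_apply]
        refine (ContinuousLinearMap.le_opNorm _ _).trans ?_
        exact mul_le_mul (hA _ hI _ (hX i hin)) (hW _ hI) (norm_nonneg _) hθ
      refine (norm_sub_le_norm_sub_add_norm_sub _
        (covOp μ (controlledX b x₀ n v i) (w i)) _).trans (add_le_add (h1.trans hWs') h2)
    have t3 : ‖D i (controlledY b x₀ a n v i - φ (i / n))‖ ≤
        Kb * ‖controlledY b x₀ a n v i - φ (i / n)‖ :=
      ContinuousLinearMap.le_of_opNorm_le _ (hKb _) _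
    refine (norm_add₃_le ..).trans ?_
    linarith
  have hsum : ‖∑ i ∈ Finset.range k, (1 / (n : ℝ)) • ((f i - D i (controlledY b x₀ a n v i)) +
      (g i - A i (w i)) + D i (controlledY b x₀ a n v i - φ (i / n)))‖ ≤
      θ * (B + W + 1) + ∑ i ∈ Finset.range k,
        (1 / (n : ℝ)) * (Kb * ‖controlledY b x₀ a n v i - φ (i / n)‖) := by
    refine (norm_sum_le _ _).trans ((Finset.sum_le_sum hterm).trans ?_)
    rw [Finset.sum_add_distrib]
    gcongr
    rw [Finset.sum_const, Finset.card_range, nsmul_eq_mul, ← mul_assoc, mul_one_div]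
    exact mul_le_of_le_one_left (by positivity) (natCast_div_mem_Icc hk).2
  have hR1k := hR1 k hk
  have hR2k := hR2 k hk
  have hMk := hM k hk
  rw [e]
  refine (norm_add_le _ _).trans ((add_le_add (norm_add₃_le ..) le_rfl).trans ?_)
  linarith

end Controlled

/-! ### Convergence of the controlled processes and of the relative entropy -/

section Limit

variable {d : ℕ} {b : Vec d → Vec d} {μ : Kernel (Vec d) (Vec d)} {x₀ : Vec d} {a : ℕ → ℝ}
  {X0 u : ℝ → Vec d} {K Kb L C W : ℝ} {φ : ℝ → Vec d}

/-- Deterministically, if the centred sums are small then the controlled processes are close to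
their limits. -/
theorem exists_forall_centredSum_le_imp (hb : ContDiff ℝ 1 b) (hKb : ∀ x, ‖fderiv ℝ b x‖ ≤ Kb)
    (hμ : TiltExpansion μ L C) (hA : Continuous (covOp μ))
    (ha_top : Tendsto (fun n : ℕ => a n * √(n : ℝ)) atTop atTop)
    (hX0 : IsLLNLimit b x₀ X0) (hw : ContinuousOn (tiltDirection μ X0 u K) (Icc 0 1))
    (hW : ∀ s ∈ Icc (0 : ℝ) 1, ‖tiltDirection μ X0 u K s‖ ≤ W)
    (hφ : IsControlledLimit b μ X0 u K φ) {η : ℝ} (hη : 0 < η) :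
    ∃ ε > 0, ∀ᶠ n : ℕ in atTop, ∀ v : Fin n → Vec d,
      (∀ k ≤ n, ‖centredSum b μ x₀ a X0 u K n v k‖ ≤ ε) →
      (∀ t ∈ Icc (0 : ℝ) 1, ‖interpolate n (controlledY b x₀ a n v) t - φ t‖ ≤ η) ∧
      ∀ k ≤ n, ‖controlledX b x₀ n v k - X0 (k / n)‖ ≤ η := by
  have hW0 : 0 ≤ W := (norm_nonneg _).trans (hW 0 (by simp))
  have hC := hμ.const_nonneg
  set B := (C * W + 2) * Real.exp Kb with hB
  have hB0 : 0 ≤ B := by positivity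
  -- the errors collected by the Gronwall argument add up to `η / 2` for this choice of `θ`
  set θ := min 1 (η / 2 / ((B + W + 4) * Real.exp Kb)) with hθdef
  have hθ : 0 < θ := by positivity
  have hθη : (θ * (B + W + 4)) * Real.exp Kb ≤ η / 2 := by
    have : θ ≤ η / 2 / ((B + W + 4) * Real.exp Kb) := min_le_right _ _
    rw [le_div_iff₀ (by positivity)] at this
    linarith
  have hbD : Continuous (fderiv ℝ b) := hb.continuous_fderiv one_ne_zero
  obtain ⟨δ₁, hδ₁, hD⟩ := exists_norm_sub_le_of_near_path hbD hX0.1 hθ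
  obtain ⟨δ₂, hδ₂, hA'⟩ := exists_norm_sub_le_of_near_path hA hX0.1 hθ
  set δ := min (min δ₁ δ₂) η with hδdef
  have hδ : 0 < δ := by positivity
  have hδ1 : δ ≤ δ₁ := (min_le_left _ _).trans (min_le_left _ _)
  have hδ2 : δ ≤ δ₂ := (min_le_left _ _).trans (min_le_right _ _)
  have hφuc := isCompact_Icc.uniformContinuousOn_of_continuous hφ.1
  obtain ⟨ρ, hρ, hφρ⟩ := Metric.uniformContinuousOn_iff.1 hφuc (η / 2) (by positivity)
  have hg1 : ContinuousOn (fun s => fderiv ℝ b (X0 s) (φ s)) (Icc 0 1) :=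
    (hbD.comp_continuousOn hX0.1).clm_apply hφ.1
  have hg2 : ContinuousOn (fun s => covOp μ (X0 s) (tiltDirection μ X0 u K s)) (Icc 0 1) :=
    (hA.comp_continuousOn hX0.1).clm_apply hw
  have hlim : ∀ r : ℝ, Tendsto (fun n : ℕ => r / (a n * √(n : ℝ))) atTop (𝓝 0) :=
    fun r => ha_top.const_div_atTop r
  refine ⟨θ, hθ, ?_⟩
  filter_upwards [eventually_gt_atTop 0, ha_top.eventually_gt_atTop 0,
    (hlim W).eventually_le_const hμ.pos, (hlim (C * W ^ 2)).eventually_le_const hθ,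
    (hlim B).eventually_le_const (show 0 < δ / 2 by positivity),
    eventually_norm_noiselessX_sub_le hb hKb hX0 (show 0 < δ / 2 by positivity),
    eventually_riemannSum_sub_le hg1 hθ, eventually_riemannSum_sub_le hg2 hθ,
    tendsto_one_div_atTop_nhds_zero_nat.eventually_lt_const hρ]
    with n hn hs hWs hWs' hBs hXn hR1 hR2 hnρ v hM
  have hY : ∀ k ≤ n, ‖controlledY b x₀ a n v k‖ ≤ B := fun k hk =>
    norm_controlledY_le hb hKb hμ hn hs hW hWs (hWs'.trans (min_le_left _ _))
      (fun k hk => (hM k hk).trans (min_le_left _ _)) hk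
  have hX : ∀ k ≤ n, ‖controlledX b x₀ n v k - X0 (k / n)‖ ≤ δ := fun k hk => by
    have := norm_controlledX_sub_le hn hs (hY k hk) hBs (hXn k hk)
    linarith
  refine ⟨fun t ht => ?_, fun k hk => (hX k hk).trans (min_le_right _ _)⟩
  have hgrid : ∀ k ≤ n, ‖controlledY b x₀ a n v k - φ (k / n)‖ ≤ η / 2 := fun k hk =>
    (norm_controlledY_sub_le hb hKb hμ hn hs hW hWs hWs' hθ.le
      (fun s hs x hx => hD s hs x (hx.trans hδ1)) (fun s hs x hx => hA' s hs x (hx.trans hδ2))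
      hφ hR1 hR2 hB0 hM hY (fun k hk => (hXn k hk).trans (by linarith)) hX hk).trans hθη
  have := norm_interpolate_sub_le hn hgrid (fun s hs t ht hst => by
    rw [← dist_eq_norm]
    exact (hφρ s hs t ht (by rw [Real.dist_eq]; exact hst.trans_lt hnρ)).le) ht
  linarith

/-- The event that the centred sums reach `ε`, expressed through the stopped sum. -/
def badEvent (b : Vec d → Vec d) (μ : Kernel (Vec d) (Vec d)) (x₀ : Vec d)
    (a : ℕ → ℝ) (X0 u : ℝ → Vec d) (K : ℝ) (n : ℕ) (ε : ℝ) : Set (Fin n → Vec d) :=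
  {v | ε ≤ ‖stoppedSum b x₀ n (fun i x => tiltedMean μ x (controlTilt μ a X0 u K n i))
    (a n / √(n : ℝ)) ε v n‖}

theorem norm_centredSum_le_of_notMem_badEvent {n : ℕ} {ε : ℝ} {v : Fin n → Vec d}
    (hv : v ∉ badEvent b μ x₀ a X0 u K n ε) {k : ℕ} (hk : k ≤ n) :
    ‖centredSum b μ x₀ a X0 u K n v k‖ ≤ ε := by
  obtain ⟨h1, h2⟩ := sum_eq_stoppedSum (not_le.1 hv) hk
  rw [h2] at h1
  exact h1.le

theorem tendsto_measure_badEvent (hb : Measurable b) (hμ : TiltExpansion μ L C)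
    (ha_zero : Tendsto a atTop (𝓝 0))
    (ha_top : Tendsto (fun n : ℕ => a n * √(n : ℝ)) atTop atTop)
    (hW : ∀ s ∈ Icc (0 : ℝ) 1, ‖tiltDirection μ X0 u K s‖ ≤ W)
    {Ω : ℕ → Type*} [∀ n, MeasurableSpace (Ω n)] {P : ∀ n, Measure (Ω n)}
    {V : ∀ n, Ω n → Fin n → Vec d}
    (hV : ∀ᶠ n in atTop, HasLaw (V n) (controlLaw b μ x₀ a X0 u K n) (P n))
    {ε : ℝ} (hε : 0 < ε) :
    Tendsto (fun n => P n {ω | V n ω ∈ badEvent b μ x₀ a X0 u K n ε}) atTop (𝓝 0) := by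
  have hlim : Tendsto (fun n => ENNReal.ofReal (a n ^ 2 * C / ε ^ 2)) atTop (𝓝 0) := by
    rw [← ENNReal.ofReal_zero]
    refine ENNReal.tendsto_ofReal ?_
    simpa using ((ha_zero.pow 2).mul_const C).div_const (ε ^ 2)
  refine tendsto_of_tendsto_of_tendsto_of_le_of_le' tendsto_const_nhds hlim
    (Eventually.of_forall fun _ => zero_le) ?_
  filter_upwards [eventually_gt_atTop 0, ha_top.eventually_gt_atTop 0,
    (ha_top.const_div_atTop W).eventually_le_const hμ.pos, hV] with n hn hs hWs hVn
  have hα : ∀ i < n, ‖controlTilt μ a X0 u K n i‖ ≤ L := fun i hi =>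
    (norm_controlTilt_le hs hW hi.le).trans hWs
  have hmean : ∀ i < n, Measurable fun x => tiltedMean μ x (controlTilt μ a X0 u K n i) :=
    fun i hi => hμ.measurable_mean _ (hα i hi)
  have hset : MeasurableSet (badEvent b μ x₀ a X0 u K n ε) :=
    measurableSet_le measurable_const (measurable_stoppedSum hb x₀ n _ ε hmean).norm
  have hlaw : P n {ω | V n ω ∈ badEvent b μ x₀ a X0 u K n ε} =
      controlLaw b μ x₀ a X0 u K n (badEvent b μ x₀ a X0 u K n ε) := hVn.measure_eq hset
  have hmass : ∀ i < n, ∀ v : Fin i → Vec d, tiltedControl b μ x₀ a X0 u K n i v univ ≤ 1 :=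
    fun i hi v => hμ.univ_le _ _ (hα i hi)
  have hvar : ∀ i < n, ∀ (v : Fin i → Vec d) (z : Vec d),
      ∫⁻ y, ENNReal.ofReal (‖z + (a n / √(n : ℝ)) • (y - tiltedMean μ (controlledX b x₀ n v i)
        (controlTilt μ a X0 u K n i))‖ ^ 2) ∂(tiltedControl b μ x₀ a X0 u K n i v) ≤
        ENNReal.ofReal (‖z‖ ^ 2 + (a n / √(n : ℝ)) ^ 2 * C) :=
    fun i hi v z => hμ.variance_le _ _ (hα i hi) z _
  have key := jointLaw_stoppedSum_ge_le (b := b) (x₀ := x₀) (n := n)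
    (m := fun i x => tiltedMean μ x (controlTilt μ a X0 u K n i)) (c := a n / √(n : ℝ))
    (κ := fun i v => tiltedControl b μ x₀ a X0 u K n i v) hμ.const_nonneg hε hmass hvar hb hmean
  rw [hlaw]
  refine le_trans key (le_of_eq ?_)
  have hsq : √(n : ℝ) ^ 2 = n := Real.sq_sqrt (by positivity)
  have hn0 : (n : ℝ) ≠ 0 := by exact_mod_cast hn.ne'
  congr 2
  rw [div_pow, hsq]
  field_simp

/-- The rescaled relative entropy cost of a control is bounded by an average of bounds `h i` for the
quadratic forms of the covariances. -/
theorem ofReal_mul_sum_klDiv_le (hμ : TiltExpansion μ L C) {n : ℕ} (hn : 0 < n)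
    (hs : 0 < a n * √(n : ℝ)) (hW : ∀ s ∈ Icc (0 : ℝ) 1, ‖tiltDirection μ X0 u K s‖ ≤ W)
    (hWs : W / (a n * √(n : ℝ)) ≤ L) {x : ℕ → Vec d} {h : ℕ → ℝ}
    (hh : ∀ i < n, ⟪tiltDirection μ X0 u K (i / n),
      covOp μ (x i) (tiltDirection μ X0 u K (i / n))⟫ ≤ h i) :
    ENNReal.ofReal (a n ^ 2 * n) * ((n : ℝ≥0∞)⁻¹ * ∑ i : Fin n,
      InformationTheory.klDiv (tiltedNoise μ (x i) (controlTilt μ a X0 u K n i)) (μ (x i))) ≤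
      ENNReal.ofReal ((1 / 2) * (∑ i ∈ Finset.range n, (1 / (n : ℝ)) * h i) +
        C * W ^ 3 / (a n * √(n : ℝ))) := by
  have hW0 : 0 ≤ W := (norm_nonneg _).trans (hW 0 (by simp))
  have hC := hμ.const_nonneg
  have hs2 : a n ^ 2 * n = (a n * √(n : ℝ)) ^ 2 := by
    rw [mul_pow, Real.sq_sqrt (by positivity)]
  set s := a n * √(n : ℝ) with hsdef
  have hh0 : ∀ i < n, 0 ≤ h i := fun i hi => (hμ.covOp_nonneg _ _).trans (hh i hi)
  have hn0 : (0 : ℝ) < n := by exact_mod_cast hn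
  have hterm : ∀ i : Fin n, ENNReal.ofReal (s ^ 2) *
      InformationTheory.klDiv (tiltedNoise μ (x i) (controlTilt μ a X0 u K n i)) (μ (x i)) ≤
      ENNReal.ofReal ((1 / 2) * h i + C * W ^ 3 / s) := by
    intro i
    have hα := norm_controlTilt_le (u := u) (K := K) hs hW i.2.le
    calc _ ≤ ENNReal.ofReal (s ^ 2) * ENNReal.ofReal ((1 / 2) * ⟪controlTilt μ a X0 u K n i,
            covOp μ (x i) (controlTilt μ a X0 u K n i)⟫ + C * ‖controlTilt μ a X0 u K n i‖ ^ 3) := by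
          gcongr
          exact hμ.klDiv_le _ _ (hα.trans hWs)
      _ ≤ _ := by
          rw [← ENNReal.ofReal_mul (by positivity)]
          refine ENNReal.ofReal_le_ofReal ?_
          have e : s ^ 2 * ⟪controlTilt μ a X0 u K n i,
              covOp μ (x i) (controlTilt μ a X0 u K n i)⟫ =
              ⟪tiltDirection μ X0 u K (i / n),
                covOp μ (x i) (tiltDirection μ X0 u K (i / n))⟫ := by
            rw [controlTilt, map_smul, real_inner_smul_left, real_inner_smul_right, ← hsdef]
            field_simp
          have h1 := hh i i.2
          have h2 : s ^ 2 * (C * ‖controlTilt μ a X0 u K n i‖ ^ 3) ≤ C * W ^ 3 / s := by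
            calc _ ≤ s ^ 2 * (C * (W / s) ^ 3) := by gcongr
              _ = _ := by field_simp
          calc _ = (1 / 2) * (s ^ 2 * ⟪controlTilt μ a X0 u K n i,
                covOp μ (x i) (controlTilt μ a X0 u K n i)⟫) +
                s ^ 2 * (C * ‖controlTilt μ a X0 u K n i‖ ^ 3) := by ring
            _ ≤ _ := by rw [e]; gcongr
  have hinv : (n : ℝ≥0∞)⁻¹ = ENNReal.ofReal (1 / n) := by
    rw [one_div, ENNReal.ofReal_inv_of_pos hn0, ENNReal.ofReal_natCast]
  rw [hs2, mul_left_comm, Finset.mul_sum, hinv]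
  calc _ ≤ ENNReal.ofReal (1 / n) * ∑ i : Fin n, ENNReal.ofReal ((1 / 2) * h i + C * W ^ 3 / s) := by
        gcongr with i
        exact hterm i
    _ = ENNReal.ofReal ((1 / n) * ∑ i : Fin n, ((1 / 2) * h i + C * W ^ 3 / s)) := by
        rw [ENNReal.ofReal_mul (by positivity), ENNReal.ofReal_sum_of_nonneg]
        intro i _
        have := hh0 i i.2
        positivity
    _ = _ := by
        congr 1
        rw [Fin.sum_univ_eq_sum_range (fun i => (1 / 2) * h i + C * W ^ 3 / s),
          Finset.sum_add_distrib, Finset.sum_const, Finset.card_range, ← Finset.mul_sum,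
          ← Finset.mul_sum, nsmul_eq_mul]
        field_simp

end Limit

end ModerateDeviations

open ModerateDeviations
theorem mainTheorem5 {d : ℕ} (b : Vec d → Vec d) (μ : Kernel (Vec d) (Vec d)) [IsMarkovKernel μ]
    (hcond : MainCondition b μ) (x₀ : Vec d) (a : ℕ → ℝ)
    (ha_zero : Tendsto a atTop (𝓝 0))
    (ha_top : Tendsto (fun n : ℕ => a n * √(n : ℝ)) atTop atTop)
    (X0 : ℝ → Vec d) (hX0 : IsLLNLimit b x₀ X0)
    (u : ℝ → Vec d) (hu : ContinuousOn u (Icc 0 1)) (K : ℝ) (hK : 0 ≤ K)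
    (φ : ℝ → Vec d) (hφ : IsControlledLimit b μ X0 u K φ)
    {Ω : ℕ → Type*} [∀ n, MeasurableSpace (Ω n)] (P : ∀ n, Measure (Ω n))
    (V : ∀ n, Ω n → Fin n → Vec d)
    (hV : ∀ᶠ n in atTop, HasLaw (V n) (controlLaw b μ x₀ a X0 u K n) (P n)) :
    (∀ ε : ℝ≥0∞, 0 < ε →
      Tendsto (fun n => P n {ω | ε ≤
        uniformDist (interpolate n (controlledY b x₀ a n (V n ω))) φ}) atTop (𝓝 0)) ∧
    limsup (fun n : ℕ => ENNReal.ofReal (a n ^ 2 * n) *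
        ∫⁻ ω, (n : ℝ≥0∞)⁻¹ * ∑ i : Fin n,
          InformationTheory.klDiv (tiltedControl b μ x₀ a X0 u K n i (V n ω))
            (μ (controlledX b x₀ n (V n ω) i)) ∂(P n)) atTop ≤
      ENNReal.ofReal ((1 / 2) * ∫ s in (0 : ℝ)..1,
        weightedSqNorm (covMatrix μ (X0 s)) (tiltDirection μ X0 u K s)) := by
  obtain ⟨L, C, hμ⟩ := hcond.exists_tiltExpansion
  obtain ⟨Kb, hKb'⟩ := hcond.drift_bound
  have hKb : ∀ x, ‖fderiv ℝ b x‖ ≤ Kb := fun x => (hKb' x).2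
  have hb := hcond.drift_contDiff
  have hA := continuous_covOp hcond.continuous_covMatrix
  have hw := continuousOn_tiltDirection hcond.continuous_covMatrix hX0.1 hu hK
  obtain ⟨W, hW⟩ := isCompact_Icc.exists_bound_of_continuousOn hw
  have hW0 : 0 ≤ W := (norm_nonneg _).trans (hW 0 (by simp))
  have hC := hμ.const_nonneg
  have hgood {η : ℝ} (hη : 0 < η) :=
    exists_forall_centredSum_le_imp hb hKb hμ hA ha_top hX0 hw hW hφ hη
  have hbad {ε : ℝ} (hε : 0 < ε) :=
    tendsto_measure_badEvent hb.continuous.measurable hμ ha_zero ha_top hW hV hε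
  constructor
  · intro ε hε
    obtain ⟨η, hη, hηε⟩ : ∃ η : ℝ, 0 < η ∧ ENNReal.ofReal η < ε := by
      obtain ⟨r, hr0, hr⟩ := ENNReal.lt_iff_exists_nnreal_btwn.1 hε
      exact ⟨r, by exact_mod_cast hr0, by simpa using hr⟩
    obtain ⟨ε', hε', hev⟩ := hgood hη
    refine tendsto_of_tendsto_of_tendsto_of_le_of_le' tendsto_const_nhds (hbad hε')
      (Eventually.of_forall fun _ => zero_le) ?_
    filter_upwards [hev] with n hn
    refine measure_mono fun ω hω => ?_
    by_contra hnot
    have h1 := (hn (V n ω) fun k hk => norm_centredSum_le_of_notMem_badEvent hnot hk).1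
    refine absurd (hηε.trans_le hω) (not_lt.2 (iSup₂_le fun t ht => ?_))
    rw [edist_dist, dist_eq_norm]
    exact ENNReal.ofReal_le_ofReal (h1 t ht)
  · set g : ℝ → ℝ := fun s => ⟪tiltDirection μ X0 u K s, covOp μ (X0 s) (tiltDirection μ X0 u K s)⟫
      with hg
    change _ ≤ ENNReal.ofReal ((1 / 2) * ∫ s in (0 : ℝ)..1, g s)
    have hgc : ContinuousOn g (Icc 0 1) := hw.inner ((hA.comp_continuousOn hX0.1).clm_apply hw)
    refine ENNReal.le_of_forall_pos_le_add fun r hr _ => ?_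
    have hr' : (0 : ℝ) < r := hr
    -- four error terms, each contributing at most `r / 4`
    set θ : ℝ := r / (4 * (W ^ 2 + 1)) with hθdef
    have hθ : 0 < θ := by positivity
    have hθ1 : θ * (W ^ 2 + 1) = r / 4 := by rw [hθdef]; field_simp
    obtain ⟨δ, hδ, hAδ⟩ := exists_norm_sub_le_of_near_path hA hX0.1 hθ
    obtain ⟨ε, hε, hev⟩ := hgood hδ
    set D : ℝ := (1 / 2) * (C * W ^ 2) + r / 4
    have hbadD : Tendsto (fun n => ENNReal.ofReal D *
        P n {ω | V n ω ∈ badEvent b μ x₀ a X0 u K n ε}) atTop (𝓝 0) := by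
      simpa using ENNReal.Tendsto.const_mul (hbad hε) (Or.inr ENNReal.ofReal_ne_top)
    refine limsup_le_of_le (by isBoundedDefault) ?_
    filter_upwards [eventually_gt_atTop 0, ha_top.eventually_gt_atTop 0,
      (ha_top.const_div_atTop W).eventually_le_const hμ.pos,
      (ha_top.const_div_atTop (C * W ^ 3)).eventually_le_const (show 0 < (r : ℝ) / 4 by positivity),
      hV, hev, eventually_riemannSum_sub_le hgc (show 0 < (r : ℝ) / 4 by positivity),
      hbadD.eventually_le_const (show (0 : ℝ≥0∞) < ENNReal.ofReal (r / 4) by simpa using hr)]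
      with n hn hs hWs hCs hVn hevn hRn hbn
    have hPn : P n univ ≤ 1 := by
      have h1 : P n univ = controlLaw b μ x₀ a X0 u K n univ := by
        rw [← hVn.map_eq, Measure.map_apply_of_aemeasurable hVn.aemeasurable MeasurableSet.univ,
          preimage_univ]
      rw [h1]
      exact jointLaw_univ_le_one fun i hi v =>
        hμ.univ_le _ _ ((norm_controlTilt_le hs hW hi.le).trans hWs)
    set S := {ω | V n ω ∈ badEvent b μ x₀ a X0 u K n ε} with hS
    have havg : ∀ c : ℝ, ∑ _i ∈ Finset.range n, (1 / (n : ℝ)) * c = c := by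
      intro c
      have hn0 : (n : ℝ) ≠ 0 := by exact_mod_cast hn.ne'
      rw [Finset.sum_const, Finset.card_range, nsmul_eq_mul]
      field_simp
    set G : ℝ := (1 / 2) * ∫ s in (0 : ℝ)..1, g s
    have hpt : ∀ ω, ENNReal.ofReal (a n ^ 2 * n) * ((n : ℝ≥0∞)⁻¹ * ∑ i : Fin n,
        InformationTheory.klDiv (tiltedControl b μ x₀ a X0 u K n i (V n ω))
          (μ (controlledX b x₀ n (V n ω) i))) ≤
        ENNReal.ofReal (G + 3 * (r / 4)) + S.indicator (fun _ => ENNReal.ofReal D) ω := by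
      intro ω
      by_cases hω : ω ∈ S
      · rw [indicator_of_mem hω]
        refine le_add_of_nonneg_of_le zero_le ?_
        refine (ofReal_mul_sum_klDiv_le hμ hn hs hW hWs (x := controlledX b x₀ n (V n ω))
          (h := fun _ => C * W ^ 2) fun i hi => ?_).trans (ENNReal.ofReal_le_ofReal ?_)
        · have hwi := hW _ (natCast_div_mem_Icc hi.le)
          refine (real_inner_le_norm _ _).trans ?_
          calc _ ≤ W * (C * W) := by
                gcongr
                exact (hμ.covOp_le _ _).trans (by gcongr)
            _ = _ := by ring
        · rw [havg]
          exact add_le_add le_rfl hCs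
      · rw [indicator_of_notMem hω, add_zero]
        have hX := (hevn (V n ω) fun k hk => norm_centredSum_le_of_notMem_badEvent hω hk).2
        refine (ofReal_mul_sum_klDiv_le hμ hn hs hW hWs (x := controlledX b x₀ n (V n ω))
          (h := fun i => g (i / n) + θ * W ^ 2) fun i hi => ?_).trans
          (ENNReal.ofReal_le_ofReal ?_)
        · have hI := natCast_div_mem_Icc hi.le
          have hwi := hW _ hI
          set w := tiltDirection μ X0 u K (i / n) with hwdef
          have e : ⟪w, covOp μ (controlledX b x₀ n (V n ω) i) w⟫ = g (i / n) +
              ⟪w, (covOp μ (controlledX b x₀ n (V n ω) i) - covOp μ (X0 (i / n))) w⟫ := by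
            simp only [hg, ← hwdef, sub_apply, inner_sub_right]; ring
          rw [e]
          gcongr
          refine (real_inner_le_norm _ _).trans ?_
          calc _ ≤ W * (θ * W) := by
                gcongr
                refine (ContinuousLinearMap.le_opNorm _ _).trans ?_
                gcongr
                exact hAδ _ hI _ (hX i hi.le)
            _ = _ := by ring
        · have h2 := hRn n le_rfl
          rw [div_self (show (n : ℝ) ≠ 0 by exact_mod_cast hn.ne'), Real.norm_eq_abs] at h2
          have h3 := (abs_le.1 h2).2
          simp only [smul_eq_mul] at h3
          simp only [mul_add, Finset.sum_add_distrib, havg]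
          simp only [G]
          nlinarith
    rw [← lintegral_const_mul' _ _ ENNReal.ofReal_ne_top]
    refine (lintegral_mono hpt).trans ?_
    rw [lintegral_add_left measurable_const, lintegral_const]
    have hG0 : 0 ≤ G := by
      refine mul_nonneg (by norm_num) (intervalIntegral.integral_nonneg zero_le_one fun s _ => ?_)
      exact hμ.covOp_nonneg _ _
    calc _ ≤ ENNReal.ofReal (G + 3 * (r / 4)) * 1 + ENNReal.ofReal (r / 4) := by
          gcongr
          exact (lintegral_indicator_const_le _ _).trans hbn
      _ = ENNReal.ofReal (G + r) := by
          rw [mul_one, ← ENNReal.ofReal_add (by positivity) (by positivity)]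
          congr 1; ring
      _ = ENNReal.ofReal G + r := by
          rw [ENNReal.ofReal_add hG0 hr'.le, ENNReal.ofReal_coe_nnreal]
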